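/- Let $\Omega=(x_i,x_f)\subseteq\mathbb{R}$ be a bounded or unbounded open interval and let $f,h$ be two probability density functions on $\mathbb{R}$ with $\operatorname{supp} f=\operatorname{supp} h=\overline{\Omega}$ and $f>0$, $h>0$ on $\Omega$. Let $\alpha>0$. Let $y$ be an indefinite integral of $f^{1-\alpha}h^{\alpha}$ on $\Omega$, that is $y'(x)=f(x)^{1-\alpha}h(x)^{\alpha}$, and let $$f_\alpha^{[h]}(y(x))=\left(\frac{f(x)}{h(x)}\right)^{\alpha}\quad(x\in\Omega),\qquad f_\alpha^{[h]}=0\ \text{ off } y(\Omega),$$ be the relative differential-escort transformed density. Write $$D[f||h]=\int_\Omega f\log\frac fh\,dx\in[0,\infty],\qquad \sigma_{q,\alpha}[f||h]=\left(\int_{\mathbb{R}}|t|^{q}f_\alpha^{[h]}(t)\,dt\right)^{\frac1{q\alpha}},$$ $$\phi_{p,\alpha}[f||h]=\left(\int_\Omega f^{1+p(\alpha-1)}h^{-\alpha p}\left|\frac{d}{dx}\log\frac fh\right|^{p}dx\right)^{\frac1{p\alpha}}.$$ For the canonical choice $y(x)=\int_{x_i}^x f^{1-\alpha}h^{\alpha}\,ds$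 one has $\sigma_{q,\alpha}[f||h]^{q\alpha}=\int_\Omega\left(\int_{x_i}^x f^{1-\alpha}h^\alpha\,ds\right)^{q}f(x)\,dx$, and this formula, with values in $[0,\infty]$, defines $\sigma_{q,\alpha}[f||h]$ for that choice even when the inner integral diverges. Let $p^*$ be the Hölder conjugate of $p$, let $g_{p,1}(x)=a\,e^{-|x|^{p^*}}$ with $a^{-1}=\int_{\mathbb{R}}e^{-|x|^{p^*}}dx$ (for $p=1$, $p^*=\infty$, $g_{1,1}$ is the uniform density on $[-1,1]$), and for a density $g$ let $N[g]=\exp\left(-\int g\log g\right)$, $\sigma_q[g]=\left(\int|x|^qg\,dx\right)^{1/q}$ and $\phi_{p,1}[g]=\left(\int|g'/g|^p g\,dx\right)^{1/p}$ ($\phi_{1,1}[g_{1,1}]$ being the total variation of $g_{1,1}$). Put $$K^{(0)}_{p,1}=\frac{\sigma_{p^*}[g_{p,1}]}{N[g_{p,1}]},\qquad K^{(1)}_{p,1}=\phi_{p,1}[g_{p,1}]\,N[g_{p,1}].$$ Then: (1) If $p^*\in(0,\infty)$, then, for the canonical choice of $y$ and for every other choice of the additive constant in $y$, $$\sigma_{p^*,\alpha}[f||h]\,e^{D[f||h]}\geq\left(K^{(0)}_{p,1}\right)^{1/\alpha}.$$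 (2) If $p\geq1$, $f$ and $h$ are differentiable on $\Omega$, and $f_\alpha^{[h]}$ is (locally) absolutely continuous on $\mathbb{R}$, then $$e^{-D[f||h]}\,\phi_{p,\alpha}[f||h]\geq\left(\frac{K^{(1)}_{p,1}}{\alpha}\right)^{1/\alpha},$$ unless $D[f||h]$ and $\phi_{p,\alpha}[f||h]$ are both infinite, in which case the left-hand side is undefined. -/

import Mathlib

open MeasureTheory Set
open scoped ENNReal

noncomputable section

namespace RelEscort

/-! ### Densities on a common interval -/

/-- The open interval `(a, b)` of real numbers, bounded or unbounded (`a = -∞`, `b = +∞` are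
allowed). -/
def Omega (a b : EReal) : Set ℝ := {x : ℝ | a < (x : EReal) ∧ (x : EReal) < b}

/-- `f` is a probability density on the real line whose support is the closure of `(a, b)` and
which is positive at every point of `(a, b)`. -/
structure IsDensityOn (a b : EReal) (f : ℝ → ℝ) : Prop where
  measurable : Measurable f
  nonneg : ∀ x, 0 ≤ f x
  lintegral_eq_one : ∫⁻ x, ENNReal.ofReal (f x) = 1
  support_eq : tsupport f = closure (Omega a b)
  pos : ∀ x ∈ Omega a b, 0 < f x

/-! ### Moments, Shannon entropy, Fisher information of one density -/

/-- The `p`-th absolute moment `∫ |x|^p g(x) dx`, possibly infinite. -/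
def absMoment (p : ℝ) (g : ℝ → ℝ) : ℝ≥0∞ := ∫⁻ x, ENNReal.ofReal (|x| ^ p * g x)

/-- The `p`-th deviation `σ_p[g]`, for `p > 0`. -/
def deviation (p : ℝ) (g : ℝ → ℝ) : ℝ≥0∞ := absMoment p g ^ (1 / p)

/-- The Shannon entropy `S[g] = -∫ g log g`. -/
def shannonEntropy (g : ℝ → ℝ) : ℝ := -∫ x, g x * Real.log (g x)

/-- The Shannon entropy power `N[g] = e^{S[g]}`. -/
def entropyPower (g : ℝ → ℝ) : ℝ≥0∞ := ENNReal.ofReal (Real.exp (shannonEntropy g))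

/-- The `(p, l)`-Fisher information `(∫ |g^{l-2} g'|^p g)^{1/(p l)}`. -/
def fisherInfo (p l : ℝ) (g : ℝ → ℝ) : ℝ≥0∞ :=
  (∫⁻ x, ENNReal.ofReal (|g x ^ (l - 2) * deriv g x| ^ p * g x)) ^ (1 / (p * l))

/-! ### Stretched Gaussians and the two constants -/

/-- The density `x ↦ a e^{-|x|^q}` with `a = 1 / ∫ e^{-|x|^q} dx`; it is `g_{p,1}`
for `q = p*`, the Hölder conjugate of `p`. -/
def stretchedGaussian (q : ℝ) (x : ℝ) : ℝ :=
  (∫ t : ℝ, Real.exp (-|t| ^ q))⁻¹ * Real.exp (-|x| ^ q)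

/-- The uniform density on `[-1, 1]`, the limit of `stretchedGaussian q` as `q → ∞`;
it is `g_{p,1}` for `p = 1`. -/
def uniformDensity (x : ℝ) : ℝ := (Icc (-1 : ℝ) 1).indicator (fun _ => 1 / 2) x

/-- `K^{(0)}_{p,1} = σ_{p*}[g_{p,1}] / N[g_{p,1}]`, as a function of `q = p*`. -/
def momentEntropyConst (q : ℝ) : ℝ≥0∞ :=
  deviation q (stretchedGaussian q) / entropyPower (stretchedGaussian q)

/-- `K^{(1)}_{p,1} = φ_{p,1}[g_{p,1}] N[g_{p,1}]`. For `p = 1` the density `g_{p,1}` is uniform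
and its `(1, 1)`-Fisher information is its total variation. -/
def stamConst (p : ℝ) : ℝ≥0∞ :=
  if p = 1 then eVariationOn uniformDensity univ * entropyPower uniformDensity
  else fisherInfo p 1 (stretchedGaussian (p / (p - 1))) *
    entropyPower (stretchedGaussian (p / (p - 1)))

/-! ### Relative quantities of two densities -/

/-- The Kullback–Leibler divergence `D[f||h] = ∫_Ω f log (f / h)`. The negative part of the
integrand is integrable for all densities, so `+∞` is the only alternative to integrability. -/
def klDivergence (a b : EReal) (f h : ℝ → ℝ) : EReal :=
  open Classical in
  if IntegrableOn (fun x => f x * Real.log (f x / h x)) (Omega a b) then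
    ((∫ x in Omega a b, f x * Real.log (f x / h x) : ℝ) : EReal)
  else ⊤

/-- The relative Fisher divergence
`F_{p,l}[f||h] = ∫_Ω f^{1+p(l-1)} h^{-lp} |(log (f / h))'|^p`. -/
def relFisherDiv (a b : EReal) (p l : ℝ) (f h : ℝ → ℝ) : ℝ≥0∞ :=
  ∫⁻ x in Omega a b, ENNReal.ofReal
    (f x ^ (1 + p * (l - 1)) * h x ^ (-(l * p)) *
      |deriv (fun t => Real.log (f t / h t)) x| ^ p)

/-- `φ_{p,l}[f||h] = F_{p,l}[f||h]^{1/(p l)}`. -/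
def relFisher (a b : EReal) (p l : ℝ) (f h : ℝ → ℝ) : ℝ≥0∞ :=
  relFisherDiv a b p l f h ^ (1 / (p * l))

/-- `y` is a change of variable on `(a, b)` with `y' = f^{1-α} h^α`: it is an indefinite integral
of `f^{1-α} h^α` there. It is determined up to an additive constant. -/
def IsChangeOfVar (a b : EReal) (α : ℝ) (f h y : ℝ → ℝ) : Prop :=
  ∀ x₁ ∈ Omega a b, ∀ x₂ ∈ Omega a b,
    IntervalIntegrable (fun s => f s ^ (1 - α) * h s ^ α) volume x₁ x₂ ∧
      y x₂ - y x₁ = ∫ s in x₁..x₂, f s ^ (1 - α) * h s ^ α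

/-- The relative differential-escort transform `f_α^{[h]}` in the variable `y`: its value at
`y(x)`, `x ∈ (a, b)`, is `(f(x) / h(x))^α`, and it vanishes off the image of `(a, b)`. -/
def transform (a b : EReal) (α : ℝ) (f h y : ℝ → ℝ) (t : ℝ) : ℝ :=
  open Classical in
  if t ∈ y '' Omega a b then
    (f (Function.invFunOn y (Omega a b) t) / h (Function.invFunOn y (Omega a b) t)) ^ α
  else 0

/-- The relative cumulative moment `μ_{p,α}[f||h] = μ_p[f_α^{[h]}]`, for a given choice `y` of the
change of variable. -/
def relCumMoment (a b : EReal) (p α : ℝ) (f h y : ℝ → ℝ) : ℝ≥0∞ :=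
  absMoment p (transform a b α f h y)

/-- `σ_{p,α}[f||h] = μ_{p,α}[f||h]^{1/(p α)}`, for a given choice `y` of the change of variable. -/
def relCumDeviation (a b : EReal) (p α : ℝ) (f h y : ℝ → ℝ) : ℝ≥0∞ :=
  relCumMoment a b p α f h y ^ (1 / (p * α))

/-- The relative cumulative moment for the canonical change of variable
`y(x) = ∫_a^x f^{1-α} h^α`, in explicit form:
`∫_Ω (∫_a^x f(s)^{1-α} h(s)^α ds)^p f(x) dx`, possibly infinite. -/
def canonicalRelCumMoment (a b : EReal) (p α : ℝ) (f h : ℝ → ℝ) : ℝ≥0∞ :=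
  ∫⁻ x in Omega a b,
    (∫⁻ s in Omega a (x : EReal), ENNReal.ofReal (f s ^ (1 - α) * h s ^ α)) ^ p *
      ENNReal.ofReal (f x)

/-- `σ_{p,α}[f||h]` for the canonical change of variable. -/
def canonicalRelCumDeviation (a b : EReal) (p α : ℝ) (f h : ℝ → ℝ) : ℝ≥0∞ :=
  canonicalRelCumMoment a b p α f h ^ (1 / (p * α))

end RelEscort

end

namespace RelEscort

/-! ### Indefinite integrals of positive functions and the change of variables they induce -/

/-! Write w = f^(1-α) h^α = y', r = (f/h)^α, and g for the transformed density, so that g ∘ y = r.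
Since w r = f, the map y carries f dx to g dt. Hence g has entropy -α D[f||h] and q-th moment ∫
|y|^q f, and its logarithmic derivative at y(x) is α w⁻¹ (log (f/h))'(x). Both claims are therefore
the classical moment-entropy and Stam inequalities for g, raised to the power 1/α. They are proved
directly in the variable x, each from Jensen's inequality ∫ f log G ≤ log ∫ f G
(`integral_mul_log_le`) with a suitable G.

Moment-entropy: take G = exp(-c|y|^q) / r. By the change of variable
(`IsPrimitiveOn.lintegral_image`), ∫ f G is the integral of exp(-c|t|^q) over the image of y, at
most c^(-1/q) Z with Z = ∫ exp(-|t|^q). Optimizing over c gives the sharp constant.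

Stam, p > 1, q = p*: let T be the increasing transport of f dx to the stretched Gaussian γ =
exp(-|t|^q)/Z, so T' = f / γ(T) (`exists_transport`), and take G = r / γ(T). Then ∫ f G = ∫ T' r ≤ ∫
|T| |r'| by parts (`lintegral_deriv_mul_le`). As |r'| is α f times the score, Hölder in L^p(f dx)
bounds this by the Fisher divergence and ∫ |T|^q f = 1/q, the moment of γ. For p = 1 it is enough
that 2 sup r ≤ ∫ |r'|.

Both Stam arguments need r to have no positive lower bound near either end of Ω
(`exists_ratio_lt_right`, `exists_ratio_lt_left`), which comes from continuity of g on the whole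
line together with ∫ f = 1. A finite Fisher divergence then bounds r, and this already makes D
finite. -/

/-- `y` is an indefinite integral of `w` on `s`. -/
def IsPrimitiveOn (s : Set ℝ) (w y : ℝ → ℝ) : Prop :=
  ∀ x₁ ∈ s, ∀ x₂ ∈ s, IntervalIntegrable w volume x₁ x₂ ∧ y x₂ - y x₁ = ∫ t in x₁..x₂, w t

theorem IsPrimitiveOn.strictMonoOn {s : Set ℝ} {w y : ℝ → ℝ} (hs : s.OrdConnected)
    (hw : ∀ x ∈ s, 0 < w x) (hy : IsPrimitiveOn s w y) : StrictMonoOn y s := by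
  intro u hu v hv huv
  obtain ⟨hi, he⟩ := hy u hu v hv
  have := intervalIntegral.intervalIntegral_pos_of_pos_on hi
    (fun x hx => hw x (hs.out hu hv (Ioo_subset_Icc_self hx))) huv
  linarith

theorem IsPrimitiveOn.continuousOn {s : Set ℝ} {w y : ℝ → ℝ} (ho : IsOpen s)
    (hy : IsPrimitiveOn s w y) : ContinuousOn y s := by
  intro x hx
  obtain ⟨ε, hε, hb⟩ := Metric.isOpen_iff.1 ho x hx
  have hc : x - ε / 2 ∈ s := hb (by simp [abs_of_pos hε, hε])
  have hd : x + ε / 2 ∈ s := hb (by simp [abs_of_pos hε, hε])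
  obtain ⟨hi, -⟩ := hy _ hc _ hd
  have hcd : x - ε / 2 ≤ x + ε / 2 := by linarith
  have h1 := intervalIntegral.continuousOn_primitive_interval
    ((intervalIntegrable_iff_integrableOn_Icc_of_le hcd).1 hi |>.mono_set (uIcc_of_le hcd).le)
  rw [uIcc_of_le hcd] at h1
  have hn : Icc (x - ε / 2) (x + ε / 2) ∈ nhds x := Icc_mem_nhds (by linarith) (by linarith)
  have h2 : ContinuousAt
      (fun z => y (x - ε / 2) + ∫ t in (x - ε / 2)..z, w t) x :=
    continuousAt_const.add (h1.continuousAt hn)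
  refine ContinuousAt.continuousWithinAt (h2.congr ?_)
  filter_upwards [ho.mem_nhds hx] with z hz
  have := (hy _ hc z hz).2
  linarith

theorem exists_mem_gt {s : Set ℝ} (ho : IsOpen s) {x : ℝ} (hx : x ∈ s) : ∃ d ∈ s, x < d := by
  obtain ⟨ε, hε, hb⟩ := Metric.isOpen_iff.1 ho x hx
  exact ⟨x + ε / 2, hb (by simp [abs_of_pos hε, hε]), by linarith⟩

theorem exists_mem_lt {s : Set ℝ} (ho : IsOpen s) {x : ℝ} (hx : x ∈ s) : ∃ c ∈ s, c < x := by
  obtain ⟨ε, hε, hb⟩ := Metric.isOpen_iff.1 ho x hx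
  exact ⟨x - ε / 2, hb (by simp [abs_of_pos hε, hε]), by linarith⟩

theorem exists_rat_mem_Ioo_of_isOpen {s : Set ℝ} (ho : IsOpen s) {x : ℝ} (hx : x ∈ s) :
    ∃ p q : ℚ, (p : ℝ) ∈ s ∧ (q : ℝ) ∈ s ∧ x ∈ Ioo (p : ℝ) q := by
  obtain ⟨ε, hε, hb⟩ := Metric.isOpen_iff.1 ho x hx
  obtain ⟨p, hp1, hp2⟩ := exists_rat_btwn (show x - ε < x by linarith)
  obtain ⟨q, hq1, hq2⟩ := exists_rat_btwn (show x < x + ε by linarith)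
  exact ⟨p, q, hb (by rw [Metric.mem_ball, Real.dist_eq, abs_lt]; constructor <;> linarith),
    hb (by rw [Metric.mem_ball, Real.dist_eq, abs_lt]; constructor <;> linarith), hp2, hq1⟩

/-- By strict monotonicity the preimage is the interval (u, v), whose w-mass is the increment of y
by definition. -/
theorem IsPrimitiveOn.withDensity_preimage_Ioo {s : Set ℝ} {w y : ℝ → ℝ} (hs : s.OrdConnected)
    (hw : ∀ x ∈ s, 0 < w x) (hy : IsPrimitiveOn s w y) {u v : ℝ} (hu : u ∈ s)
    (hv : v ∈ s) (huv : u ≤ v) :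
    (volume.withDensity fun x => ENNReal.ofReal (w x)) (y ⁻¹' Ioo (y u) (y v) ∩ s) =
      ENNReal.ofReal (y v - y u) := by
  have hm := hy.strictMonoOn hs hw
  have he : y ⁻¹' Ioo (y u) (y v) ∩ s = Ioo u v := by
    ext x
    constructor
    · rintro ⟨⟨h1, h2⟩, hx⟩
      exact ⟨(hm.lt_iff_lt hu hx).1 h1, (hm.lt_iff_lt hx hv).1 h2⟩
    · rintro ⟨h1, h2⟩
      have hx := hs.out hu hv ⟨h1.le, h2.le⟩
      exact ⟨⟨hm hu hx h1, hm hx hv h2⟩, hx⟩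
  obtain ⟨hi, hyi⟩ := hy u hu v hv
  have hioc := (intervalIntegrable_iff_integrableOn_Ioc_of_le huv).1 hi
  rw [he, withDensity_apply _ measurableSet_Ioo, hyi, intervalIntegral.integral_of_le huv,
    ofReal_integral_eq_lintegral_ofReal hioc, setLIntegral_congr Ioo_ae_eq_Ioc]
  filter_upwards [ae_restrict_mem measurableSet_Ioc] with x hx
  exact (hw x (hs.out hu hv (Ioc_subset_Icc_self hx))).le

/-- The image of `w(x) dx` on an open interval under an indefinite integral of `w > 0` is Lebesgue
measure on the image interval. -/
theorem IsPrimitiveOn.map_eq {s : Set ℝ} {w y : ℝ → ℝ} (hs : s.OrdConnected)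
    (ho : IsOpen s) (hw : ∀ x ∈ s, 0 < w x) (hy : IsPrimitiveOn s w y) :
    ((volume.withDensity fun x => ENNReal.ofReal (w x)).restrict s).map y =
      volume.restrict (y '' s) := by
  have hm := hy.strictMonoOn hs hw
  have hc := hy.continuousOn ho
  set μ : Measure ℝ := volume.withDensity fun x => ENNReal.ofReal (w x) with hμ
  have hae : AEMeasurable y (μ.restrict s) := hc.aemeasurable ho.measurableSet
  have hJm : MeasurableSet (y '' s) :=
    ((hs.isPreconnected.image y hc).ordConnected).measurableSet
  have happly : ∀ A : Set ℝ, MeasurableSet A →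
      (μ.restrict s).map y A = μ (y ⁻¹' A ∩ s) := fun A hA => by
    rw [Measure.map_apply_of_aemeasurable hae hA, Measure.restrict_apply' ho.measurableSet]
  -- As w is only measurable, y need not be differentiable everywhere. The two measures are compared
  -- on intervals instead, whose endpoints are values of y by the intermediate value theorem.
  have hpiece : ∀ c ∈ s, ∀ d ∈ s,
      ((μ.restrict s).map y).restrict (Ioo (y c) (y d)) =
        volume.restrict (Ioo (y c) (y d)) := by
    intro c hc' d hd'
    symm
    refine Real.measure_ext_Ioo_rat fun p q => ?_
    rw [Measure.restrict_apply measurableSet_Ioo, Measure.restrict_apply measurableSet_Ioo,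
      Ioo_inter_Ioo]
    rcases le_or_gt ((q : ℝ) ⊓ y d) ((p : ℝ) ⊔ y c) with hle | hlt
    · rw [Ioo_eq_empty (not_lt.2 hle)]; simp
    · have hcd : c ≤ d := (hm.le_iff_le hc' hd').1
        ((le_sup_right.trans hlt.le).trans inf_le_right)
      have hivt := intermediate_value_Icc hcd (hc.mono (hs.out hc' hd'))
      obtain ⟨u, hu, hu'⟩ := hivt ⟨le_sup_right, hlt.le.trans inf_le_right⟩
      obtain ⟨v, hv, hv'⟩ := hivt ⟨le_sup_right.trans hlt.le, inf_le_right⟩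
      have hus := hs.out hc' hd' hu
      have hvs := hs.out hc' hd' hv
      rw [← hu', ← hv'] at hlt ⊢
      rw [happly _ measurableSet_Ioo, Real.volume_Ioo,
        hy.withDensity_preimage_Ioo hs hw hus hvs ((hm.lt_iff_lt hus hvs).1 hlt).le]
  -- Rational endpoints make the cover countable, so that equality on the pieces gives equality on
  -- the image.
  have hcover : y '' s = ⋃ i : {p : ℚ × ℚ // (p.1 : ℝ) ∈ s ∧ (p.2 : ℝ) ∈ s},
      Ioo (y i.1.1) (y i.1.2) := by
    ext t
    simp only [mem_iUnion, Subtype.exists, Prod.exists]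
    constructor
    · rintro ⟨x, hx, rfl⟩
      obtain ⟨p, q, hp, hq, h1, h2⟩ := exists_rat_mem_Ioo_of_isOpen ho hx
      exact ⟨p, q, ⟨hp, hq⟩, hm hp hx h1, hm hx hq h2⟩
    · rintro ⟨p, q, ⟨hp, hq⟩, h1, h2⟩
      exact (hs.isPreconnected.image y hc).ordConnected.out ⟨_, hp, rfl⟩ ⟨_, hq, rfl⟩
        ⟨h1.le, h2.le⟩
  have hJ : ((μ.restrict s).map y).restrict (y '' s) = volume.restrict (y '' s) := by
    rw [hcover]
    exact Measure.restrict_iUnion_congr.2 fun i => hpiece _ i.2.1 _ i.2.2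
  rw [← hJ]
  refine (Measure.restrict_eq_self_of_ae_mem ?_).symm
  rw [ae_iff]
  change (Measure.map y (μ.restrict s)) (y '' s)ᶜ = 0
  rw [happly _ hJm.compl]
  convert measure_empty (μ := μ)
  ext x
  simp only [mem_inter_iff, mem_preimage, mem_compl_iff, mem_empty_iff_false, iff_false, not_and]
  exact fun h1 h2 => h1 ⟨x, h2, rfl⟩

theorem IsPrimitiveOn.lintegral_image {s : Set ℝ} {w y : ℝ → ℝ} (hs : s.OrdConnected)
    (ho : IsOpen s) (hwm : Measurable w) (hw : ∀ x ∈ s, 0 < w x) (hy : IsPrimitiveOn s w y)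
    {k : ℝ → ℝ≥0∞} (hk : AEMeasurable k (volume.restrict (y '' s))) :
    ∫⁻ t in y '' s, k t = ∫⁻ x in s, ENNReal.ofReal (w x) * k (y x) := by
  have hc := hy.continuousOn ho
  have hmap := hy.map_eq hs ho hw
  have hae : AEMeasurable y
      ((volume.withDensity fun x => ENNReal.ofReal (w x)).restrict s) :=
    hc.aemeasurable ho.measurableSet
  rw [← hmap, lintegral_map' (hmap ▸ hk) hae]
  rw [restrict_withDensity ho.measurableSet]
  rw [restrict_withDensity ho.measurableSet] at hae hmap
  rw [lintegral_withDensity_eq_lintegral_mul₀' (by fun_prop)]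
  · rfl
  · exact (show AEMeasurable k (Measure.map y _) by rw [hmap]; exact hk).comp_aemeasurable hae

/-! ### Stretched Gaussians: normalization, moment, entropy, Fisher information -/

/-- The normalization constant `∫ e^{-|t|^q} dt`. -/
noncomputable def partitionFn (q : ℝ) : ℝ := ∫ t : ℝ, Real.exp (-|t| ^ q)

theorem integral_exp_neg_mul_abs_rpow {q c : ℝ} (hq : 0 < q) (hc : 0 < c) :
    ∫ t : ℝ, Real.exp (-(c * |t| ^ q)) = c ^ (-1 / q) * (2 * Real.Gamma (1 / q + 1)) := by
  rw [integral_comp_abs (f := fun t => Real.exp (-(c * t ^ q)))]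
  simp_rw [← neg_mul]
  rw [integral_exp_neg_mul_rpow hq hc]
  ring

theorem partitionFn_eq {q : ℝ} (hq : 0 < q) : partitionFn q = 2 * Real.Gamma (1 / q + 1) := by
  simpa [partitionFn] using integral_exp_neg_mul_abs_rpow hq one_pos

theorem partitionFn_pos {q : ℝ} (hq : 0 < q) : 0 < partitionFn q := by
  rw [partitionFn_eq hq]
  have := Real.Gamma_pos_of_pos (show 0 < 1 / q + 1 by positivity)
  positivity

theorem lintegral_exp_neg_mul_abs_rpow {q c : ℝ} (hq : 0 < q) (hc : 0 < c) :
    ∫⁻ t : ℝ, ENNReal.ofReal (Real.exp (-(c * |t| ^ q))) =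
      ENNReal.ofReal (c ^ (-1 / q) * partitionFn q) := by
  have hI := integral_exp_neg_mul_abs_rpow hq hc
  rw [← partitionFn_eq hq] at hI
  have hpos : 0 < c ^ (-1 / q) * partitionFn q :=
    mul_pos (Real.rpow_pos_of_pos hc _) (partitionFn_pos hq)
  rw [← hI, ofReal_integral_eq_lintegral_ofReal]
  -- A nonzero Bochner integral forces integrability, since the default value for a non-integrable
  -- function is 0. The same device recurs below.
  · exact not_imp_comm.1 integral_undef (by rw [hI]; exact hpos.ne')
  · exact Filter.Eventually.of_forall fun _ => (Real.exp_pos _).le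

theorem stretchedGaussian_eq (q x : ℝ) :
    stretchedGaussian q x = (partitionFn q)⁻¹ * Real.exp (-|x| ^ q) := rfl

theorem stretchedGaussian_pos {q : ℝ} (hq : 0 < q) (x : ℝ) : 0 < stretchedGaussian q x :=
  mul_pos (inv_pos.2 (partitionFn_pos hq)) (Real.exp_pos _)

theorem continuous_stretchedGaussian {q : ℝ} (hq : 0 < q) : Continuous (stretchedGaussian q) := by
  have h : Continuous fun x : ℝ => |x| ^ q :=
    continuous_abs.rpow_const fun _ => Or.inr hq.le
  exact continuous_const.mul (Real.continuous_exp.comp h.neg)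

theorem integral_stretchedGaussian {q : ℝ} (hq : 0 < q) : ∫ x, stretchedGaussian q x = 1 := by
  simp_rw [stretchedGaussian_eq]
  rw [integral_const_mul]
  exact inv_mul_cancel₀ (partitionFn_pos hq).ne'

theorem integrable_stretchedGaussian {q : ℝ} (hq : 0 < q) : Integrable (stretchedGaussian q) :=
  not_imp_comm.1 integral_undef (by rw [integral_stretchedGaussian hq]; exact one_ne_zero)

theorem integral_rpow_abs_mul_stretchedGaussian {q : ℝ} (hq : 0 < q) :
    ∫ x, |x| ^ q * stretchedGaussian q x = 1 / q := by
  have h1 : ∀ x : ℝ, |x| ^ q * stretchedGaussian q x =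
      (partitionFn q)⁻¹ * (|x| ^ q * Real.exp (-|x| ^ q)) := fun x => by
    rw [stretchedGaussian_eq]; ring
  simp_rw [h1]
  rw [integral_const_mul, integral_comp_abs (f := fun t => t ^ q * Real.exp (-t ^ q)),
    integral_rpow_mul_exp_neg_rpow hq (by linarith)]
  have h2 : (q + 1) / q = 1 / q + 1 := by field_simp; ring
  rw [h2, show 2 * (1 / q * Real.Gamma (1 / q + 1)) = 1 / q * partitionFn q by
    rw [partitionFn_eq hq]; ring]
  have := (partitionFn_pos hq).ne'
  field_simp

theorem integrable_rpow_abs_mul_stretchedGaussian {q : ℝ} (hq : 0 < q) :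
    Integrable fun x => |x| ^ q * stretchedGaussian q x :=
  not_imp_comm.1 integral_undef (by
    rw [integral_rpow_abs_mul_stretchedGaussian hq]; positivity)

theorem absMoment_stretchedGaussian {q : ℝ} (hq : 0 < q) :
    absMoment q (stretchedGaussian q) = ENNReal.ofReal (1 / q) := by
  rw [absMoment, ← integral_rpow_abs_mul_stretchedGaussian hq,
    ofReal_integral_eq_lintegral_ofReal (integrable_rpow_abs_mul_stretchedGaussian hq)]
  exact Filter.Eventually.of_forall fun x =>
    mul_nonneg (by positivity) (stretchedGaussian_pos hq x).le

theorem log_stretchedGaussian {q : ℝ} (hq : 0 < q) (x : ℝ) :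
    Real.log (stretchedGaussian q x) = -Real.log (partitionFn q) - |x| ^ q := by
  rw [stretchedGaussian_eq, Real.log_mul (inv_pos.2 (partitionFn_pos hq)).ne' (Real.exp_pos _).ne',
    Real.log_inv, Real.log_exp]
  ring

theorem shannonEntropy_stretchedGaussian {q : ℝ} (hq : 0 < q) :
    shannonEntropy (stretchedGaussian q) = Real.log (partitionFn q) + 1 / q := by
  have h1 : ∀ x : ℝ, stretchedGaussian q x * Real.log (stretchedGaussian q x) =
      -Real.log (partitionFn q) * stretchedGaussian q x - |x| ^ q * stretchedGaussian q x :=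
    fun x => by rw [log_stretchedGaussian hq]; ring
  rw [shannonEntropy]
  simp_rw [h1]
  rw [integral_sub ((integrable_stretchedGaussian hq).const_mul _)
    (integrable_rpow_abs_mul_stretchedGaussian hq), integral_const_mul,
    integral_stretchedGaussian hq, integral_rpow_abs_mul_stretchedGaussian hq]
  ring

theorem entropyPower_stretchedGaussian {q : ℝ} (hq : 0 < q) :
    entropyPower (stretchedGaussian q) = ENNReal.ofReal (partitionFn q * Real.exp (1 / q)) := by
  rw [entropyPower, shannonEntropy_stretchedGaussian hq, Real.exp_add,
    Real.exp_log (partitionFn_pos hq)]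

theorem momentEntropyConst_eq {q : ℝ} (hq : 0 < q) :
    momentEntropyConst q =
      ENNReal.ofReal ((1 / q) ^ (1 / q) / (partitionFn q * Real.exp (1 / q))) := by
  have := partitionFn_pos hq
  rw [momentEntropyConst, deviation, absMoment_stretchedGaussian hq,
    entropyPower_stretchedGaussian hq, ENNReal.ofReal_rpow_of_pos (by positivity),
    ENNReal.ofReal_div_of_pos (by positivity)]

theorem abs_deriv_stretchedGaussian {q : ℝ} {x : ℝ} (hq : 0 < q) (hx : x ≠ 0) :
    |deriv (stretchedGaussian q) x| = q * |x| ^ (q - 1) * stretchedGaussian q x := by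
  have h1 : HasDerivAt (fun t : ℝ => |t| ^ q) (SignType.sign x * q * |x| ^ (q - 1)) x :=
    (hasDerivAt_abs hx).rpow_const (Or.inl (abs_pos.2 hx).ne')
  have h2 : HasDerivAt (stretchedGaussian q)
      ((partitionFn q)⁻¹ * (Real.exp (-|x| ^ q) * -(SignType.sign x * q * |x| ^ (q - 1)))) x :=
    (h1.neg.exp).const_mul _
  rw [h2.deriv, stretchedGaussian_eq, abs_mul, abs_mul, abs_neg, abs_mul, abs_mul,
    abs_of_pos (inv_pos.2 (partitionFn_pos hq)), abs_of_pos (Real.exp_pos _), abs_of_pos hq,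
    abs_of_nonneg (Real.rpow_nonneg (abs_nonneg x) _)]
  have h3 : |(SignType.sign x : ℝ)| = 1 := by
    rcases hx.lt_or_gt with h | h <;> simp [h]
  rw [h3]
  ring

/-- Away from 0 the logarithmic derivative has modulus q |x|^(q-1), and (q-1) p = q, so the integral
is q^p times the q-th moment 1/q. -/
theorem fisherInfo_stretchedGaussian {p q : ℝ} (hpq : p.HolderConjugate q) :
    fisherInfo p 1 (stretchedGaussian q) = ENNReal.ofReal (q ^ (1 / q)) := by
  have hp := hpq.pos
  have hq := hpq.symm.pos
  have h1 : ∫⁻ x, ENNReal.ofReal (|stretchedGaussian q x ^ ((1 : ℝ) - 2) *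
      deriv (stretchedGaussian q) x| ^ p * stretchedGaussian q x) =
      ENNReal.ofReal (q ^ p * (1 / q)) := by
    rw [← integral_rpow_abs_mul_stretchedGaussian hq, ← integral_const_mul,
      ofReal_integral_eq_lintegral_ofReal
        ((integrable_rpow_abs_mul_stretchedGaussian hq).const_mul _)]
    · refine lintegral_congr_ae ?_
      have h0 : ∀ᵐ x : ℝ, x ≠ 0 := by simp [ae_iff]
      filter_upwards [h0] with x hx
      have hg := stretchedGaussian_pos hq x
      rw [abs_mul, abs_deriv_stretchedGaussian hq hx, abs_of_pos (Real.rpow_pos_of_pos hg _),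
        show ((1 : ℝ) - 2) = -1 by norm_num, Real.rpow_neg_one,
        show (stretchedGaussian q x)⁻¹ * (q * |x| ^ (q - 1) * stretchedGaussian q x) =
          q * |x| ^ (q - 1) by field_simp,
        Real.mul_rpow hq.le (by positivity), ← Real.rpow_mul (abs_nonneg x),
        show (q - 1) * p = q by rw [mul_comm]; have := hpq.symm.sub_one_mul_conj; linarith]
      rw [mul_assoc]
    · exact Filter.Eventually.of_forall fun x => mul_nonneg (by positivity)
        (mul_nonneg (by positivity) (stretchedGaussian_pos hq x).le)
  rw [fisherInfo, h1, mul_one, ENNReal.ofReal_rpow_of_pos (by positivity)]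
  congr 1
  rw [one_div q, ← Real.rpow_neg_one q, ← Real.rpow_add hq, ← Real.rpow_mul hq.le,
    Real.rpow_neg_one]
  congr 1
  have := hpq.inv_add_inv_eq_one
  field_simp at this ⊢
  linarith

theorem stamConst_eq {p q : ℝ} (hpq : p.HolderConjugate q) :
    stamConst p = ENNReal.ofReal (q ^ (1 / q) * (partitionFn q * Real.exp (1 / q))) := by
  have hq := hpq.symm.pos
  rw [stamConst, if_neg hpq.lt.ne', ← hpq.conjugate_eq, fisherInfo_stretchedGaussian hpq,
    entropyPower_stretchedGaussian hq, ← ENNReal.ofReal_mul (by positivity)]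

/-- The density is even and increases from 0 to 1/2 on the negative half-line. Only this upper bound
matters, because the constant is the lower side of the Stam inequality. -/
theorem eVariationOn_uniformDensity : eVariationOn uniformDensity univ ≤ 1 := by
  have hval : ∀ x, 0 ≤ uniformDensity x ∧ uniformDensity x ≤ 1 / 2 := fun x => by
    unfold uniformDensity indicator
    split_ifs <;> norm_num
  have hmono : MonotoneOn uniformDensity (Iic 0) := by
    intro x hx y hy hxy
    by_cases h : -1 ≤ x
    · have h1 : x ∈ Icc (-1 : ℝ) 1 := ⟨h, le_trans hx zero_le_one⟩
      have h2 : y ∈ Icc (-1 : ℝ) 1 := ⟨h.trans hxy, le_trans hy zero_le_one⟩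
      simp [uniformDensity, h1, h2]
    · have h1 : x ∉ Icc (-1 : ℝ) 1 := fun h' => h h'.1
      rw [show uniformDensity x = 0 by simp only [uniformDensity, indicator_of_notMem h1]]
      exact (hval y).1
  have hl : eVariationOn uniformDensity (Iic 0) ≤ ENNReal.ofReal (1 / 2) := by
    rw [eVariationOn.eq_biSup_inter_Icc]
    refine iSup₂_le fun c hc => ?_
    rw [hmono.eVariationOn_eq hc.1 hc.2.1]
    exact ENNReal.ofReal_le_ofReal (by linarith [(hval c.1).1, (hval c.2).2])
  have heven : uniformDensity ∘ Neg.neg = uniformDensity := by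
    ext x
    simp only [uniformDensity, indicator, Function.comp, mem_Icc, neg_le_neg_iff, neg_le (a := x),
      and_comm]
  have hr : eVariationOn uniformDensity (Ici 0) ≤ ENNReal.ofReal (1 / 2) := by
    refine le_trans ?_ hl
    nth_rw 1 [← heven]
    exact eVariationOn.comp_le_of_antitoneOn _ _ (fun x _ y _ h => neg_le_neg h)
      fun x hx => by simpa using hx
  have hu : (univ : Set ℝ) = Iic 0 ∪ Ici 0 := Iic_union_Ici.symm
  rw [hu, eVariationOn.union _ (isGreatest_Iic (a := (0 : ℝ))) isLeast_Ici]
  calc _ ≤ ENNReal.ofReal (1 / 2) + ENNReal.ofReal (1 / 2) := add_le_add hl hr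
    _ = 1 := by rw [← ENNReal.ofReal_add (by norm_num) (by norm_num)]; norm_num

theorem entropyPower_uniformDensity : entropyPower uniformDensity = 2 := by
  have h : ∀ x, uniformDensity x * Real.log (uniformDensity x) =
      (Icc (-1 : ℝ) 1).indicator (fun _ => 1 / 2 * Real.log (1 / 2)) x := fun x => by
    unfold uniformDensity indicator
    split_ifs <;> simp
  rw [entropyPower, shannonEntropy]
  simp_rw [h]
  rw [integral_indicator_const _ measurableSet_Icc]
  simp only [Real.volume_real_Icc, smul_eq_mul]
  rw [show -(max (1 - -1 : ℝ) 0 * (1 / 2 * Real.log (1 / 2))) = Real.log 2 by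
    rw [one_div, Real.log_inv]; norm_num; ring, Real.exp_log two_pos]
  norm_num

theorem stamConst_one_le : stamConst 1 ≤ 2 := by
  rw [stamConst, if_pos rfl, entropyPower_uniformDensity]
  simpa using mul_le_mul_left eVariationOn_uniformDensity 2

/-! ### Two densities on a common interval -/

theorem isOpen_Omega (a b : EReal) : IsOpen (Omega a b) :=
  (isOpen_lt continuous_const continuous_coe_real_ereal).inter
    (isOpen_lt continuous_coe_real_ereal continuous_const)

theorem ordConnected_Omega (a b : EReal) : (Omega a b).OrdConnected :=
  ⟨fun _ hx _ hy _ hz => ⟨hx.1.trans_le (EReal.coe_le_coe_iff.2 hz.1),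
    (EReal.coe_le_coe_iff.2 hz.2).trans_lt hy.2⟩⟩

theorem measurableSet_Omega (a b : EReal) : MeasurableSet (Omega a b) :=
  (isOpen_Omega a b).measurableSet

variable {a b : EReal} {f h : ℝ → ℝ} {α : ℝ} {y : ℝ → ℝ}

theorem IsDensityOn.setLIntegral (hf : IsDensityOn a b f) :
    ∫⁻ x in Omega a b, ENNReal.ofReal (f x) = 1 := by
  rw [← hf.lintegral_eq_one, ← lintegral_indicator (measurableSet_Omega a b)]
  -- The support condition still allows f to be nonzero at the endpoints of Ω; they form a null set.
  have hfr : volume (frontier (Omega a b)) = 0 :=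
    (ordConnected_Omega a b).convex.addHaar_frontier volume
  refine lintegral_congr_ae ?_
  filter_upwards [compl_mem_ae_iff.2 hfr] with x hx
  by_cases hxO : x ∈ Omega a b
  · rw [indicator_of_mem hxO]
  · rw [indicator_of_notMem hxO]
    have : x ∉ tsupport f := by
      rw [hf.support_eq]
      intro hc
      exact hx ⟨hc, fun hi => hxO (interior_subset hi)⟩
    rw [image_eq_zero_of_notMem_tsupport this, ENNReal.ofReal_zero]

theorem IsDensityOn.integrableOn (hf : IsDensityOn a b f) : IntegrableOn f (Omega a b) := by
  refine ⟨hf.measurable.aestronglyMeasurable, ?_⟩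
  rw [hasFiniteIntegral_iff_ofReal (Filter.Eventually.of_forall hf.nonneg), hf.setLIntegral]
  exact ENNReal.one_lt_top

theorem IsDensityOn.setIntegral (hf : IsDensityOn a b f) : ∫ x in Omega a b, f x = 1 := by
  rw [integral_eq_lintegral_of_nonneg_ae (Filter.Eventually.of_forall hf.nonneg)
    hf.measurable.aestronglyMeasurable, hf.setLIntegral, ENNReal.toReal_one]

theorem IsDensityOn.volume_ne_zero (hf : IsDensityOn a b f) : volume (Omega a b) ≠ 0 := by
  intro h0
  have := hf.setLIntegral
  rw [setLIntegral_measure_zero _ _ h0] at this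
  exact zero_ne_one this

theorem IsDensityOn.nonempty (hf : IsDensityOn a b f) : (Omega a b).Nonempty := by
  by_contra h
  exact hf.volume_ne_zero (by rw [not_nonempty_iff_eq_empty.1 h, measure_empty])

/-- The derivative `f^{1-α} h^α` of the change of variable. -/
noncomputable def weight (α : ℝ) (f h : ℝ → ℝ) (x : ℝ) : ℝ := f x ^ (1 - α) * h x ^ α

/-- The power `(f / h)^α`, which is the transformed density in the original variable. -/
noncomputable def ratio (α : ℝ) (f h : ℝ → ℝ) (x : ℝ) : ℝ := (f x / h x) ^ α

theorem measurable_weight (hf : IsDensityOn a b f) (hh : IsDensityOn a b h) :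
    Measurable (weight α f h) :=
  (hf.measurable.pow_const _).mul (hh.measurable.pow_const _)

theorem measurable_ratio (hf : IsDensityOn a b f) (hh : IsDensityOn a b h) :
    Measurable (ratio α f h) :=
  (hf.measurable.div hh.measurable).pow_const _

theorem weight_pos (hf : IsDensityOn a b f) (hh : IsDensityOn a b h) {x : ℝ}
    (hx : x ∈ Omega a b) : 0 < weight α f h x :=
  mul_pos (Real.rpow_pos_of_pos (hf.pos x hx) _) (Real.rpow_pos_of_pos (hh.pos x hx) _)

theorem ratio_pos (hf : IsDensityOn a b f) (hh : IsDensityOn a b h) {x : ℝ}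
    (hx : x ∈ Omega a b) : 0 < ratio α f h x :=
  Real.rpow_pos_of_pos (div_pos (hf.pos x hx) (hh.pos x hx)) _

/-- This identity w r = f is what makes y carry f dx to the transformed density. -/
theorem weight_mul_ratio (hf : IsDensityOn a b f) (hh : IsDensityOn a b h) {x : ℝ}
    (hx : x ∈ Omega a b) : weight α f h x * ratio α f h x = f x := by
  have h1 := hf.pos x hx
  have h2 := hh.pos x hx
  have h3 := Real.rpow_pos_of_pos h2 α
  have h4 := Real.rpow_pos_of_pos h1 α
  rw [weight, ratio, Real.div_rpow h1.le h2.le, Real.rpow_sub h1, Real.rpow_one]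
  field_simp

theorem log_ratio (hf : IsDensityOn a b f) (hh : IsDensityOn a b h) {x : ℝ}
    (hx : x ∈ Omega a b) : Real.log (ratio α f h x) = α * Real.log (f x / h x) :=
  Real.log_rpow (div_pos (hf.pos x hx) (hh.pos x hx)) _

theorem IsChangeOfVar.isPrimitiveOn (hy : IsChangeOfVar a b α f h y) :
    IsPrimitiveOn (Omega a b) (weight α f h) y := hy

theorem IsChangeOfVar.strictMonoOn (hf : IsDensityOn a b f) (hh : IsDensityOn a b h)
    (hy : IsChangeOfVar a b α f h y) : StrictMonoOn y (Omega a b) :=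
  hy.isPrimitiveOn.strictMonoOn (ordConnected_Omega a b) fun _ hx => weight_pos hf hh hx

theorem transform_apply (hf : IsDensityOn a b f) (hh : IsDensityOn a b h)
    (hy : IsChangeOfVar a b α f h y) {x : ℝ} (hx : x ∈ Omega a b) :
    transform a b α f h y (y x) = ratio α f h x := by
  rw [transform, if_pos (mem_image_of_mem y hx),
    (hy.strictMonoOn hf hh).injOn.leftInvOn_invFunOn hx, ratio]

theorem transform_of_notMem {t : ℝ} (ht : t ∉ y '' Omega a b) :
    transform a b α f h y t = 0 := by
  rw [transform, if_neg ht]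

theorem measurableSet_image (hy : IsChangeOfVar a b α f h y) :
    MeasurableSet (y '' Omega a b) :=
  (((ordConnected_Omega a b).isPreconnected.image y
    (hy.isPrimitiveOn.continuousOn (isOpen_Omega a b))).ordConnected).measurableSet

-- The inverse of y is monotone on the image, hence measurable there.
theorem aemeasurable_transform (hf : IsDensityOn a b f) (hh : IsDensityOn a b h)
    (hy : IsChangeOfVar a b α f h y) :
    AEMeasurable (transform a b α f h y) (volume.restrict (y '' Omega a b)) := by
  have hJ := measurableSet_image hy
  have hm := hy.strictMonoOn hf hh
  have hinv : MonotoneOn (Function.invFunOn y (Omega a b)) (y '' Omega a b) := by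
    rintro _ ⟨u, hu, rfl⟩ _ ⟨v, hv, rfl⟩ huv
    rw [hm.injOn.leftInvOn_invFunOn hu, hm.injOn.leftInvOn_invFunOn hv]
    exact (hm.le_iff_le hu hv).1 huv
  refine ((measurable_ratio (α := α) hf hh).comp_aemeasurable
    (aemeasurable_restrict_of_monotoneOn hJ hinv)).congr ?_
  filter_upwards [ae_restrict_mem hJ] with t ht
  rw [transform, if_pos ht]
  rfl

/-- The relative cumulative moment in the original variable. -/
theorem relCumMoment_eq (hf : IsDensityOn a b f) (hh : IsDensityOn a b h)
    (hy : IsChangeOfVar a b α f h y) (q : ℝ) :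
    relCumMoment a b q α f h y =
      ∫⁻ x in Omega a b, ENNReal.ofReal (|y x| ^ q * f x) := by
  have hJ := measurableSet_image hy
  have h1 : relCumMoment a b q α f h y = ∫⁻ t in y '' Omega a b,
      ENNReal.ofReal (|t| ^ q * transform a b α f h y t) := by
    rw [relCumMoment, absMoment, ← lintegral_indicator hJ]
    refine lintegral_congr fun t => ?_
    by_cases ht : t ∈ y '' Omega a b
    · rw [indicator_of_mem ht]
    · rw [indicator_of_notMem ht, transform_of_notMem ht, mul_zero, ENNReal.ofReal_zero]
  have hk : AEMeasurable (fun t => ENNReal.ofReal (|t| ^ q * transform a b α f h y t))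
      (volume.restrict (y '' Omega a b)) :=
    ((measurable_id.abs.pow_const q).aemeasurable.mul
      (aemeasurable_transform hf hh hy)).ennreal_ofReal
  rw [h1, hy.isPrimitiveOn.lintegral_image (ordConnected_Omega a b) (isOpen_Omega a b)
    (measurable_weight hf hh) (fun _ hx => weight_pos hf hh hx) hk]
  refine setLIntegral_congr_fun (measurableSet_Omega a b) fun x hx => ?_
  rw [transform_apply hf hh hy hx, ← ENNReal.ofReal_mul (weight_pos hf hh hx).le,
    ← weight_mul_ratio (α := α) hf hh hx]
  congr 1
  ring

/-- Jensen's inequality for the logarithm. -/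
theorem integral_mul_log_le {X : Type*} [MeasurableSpace X] {μ : Measure X} {f g : X → ℝ} {A : ℝ}
    (hA : 0 < A) (hf : Integrable f μ) (hf1 : ∫ x, f x ∂μ = 1) (hf0 : ∀ᵐ x ∂μ, 0 ≤ f x)
    (hg0 : ∀ᵐ x ∂μ, 0 < g x) (hgm : AEStronglyMeasurable g μ)
    (hlog : Integrable (fun x => f x * Real.log (g x)) μ)
    (hle : ∫⁻ x, ENNReal.ofReal (f x * g x) ∂μ ≤ ENNReal.ofReal A) :
    ∫ x, f x * Real.log (g x) ∂μ ≤ Real.log A := by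
  have hnn : 0 ≤ᵐ[μ] fun x => f x * g x := by
    filter_upwards [hf0, hg0] with x h1 h2 using mul_nonneg h1 h2.le
  have hm : AEStronglyMeasurable (fun x => f x * g x) μ := hf.aestronglyMeasurable.mul hgm
  have hint : Integrable (fun x => f x * g x) μ :=
    ⟨hm, (hasFiniteIntegral_iff_ofReal hnn).2 (hle.trans_lt ENNReal.ofReal_lt_top)⟩
  have hI : ∫ x, f x * g x ∂μ ≤ A := by
    rw [integral_eq_lintegral_of_nonneg_ae hnn hm]
    exact ENNReal.toReal_le_of_le_ofReal hA.le hle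
  -- Tangent line of the logarithm at A: log g ≤ log A + g/A - 1, integrated against f.
  have hb : ∫ x, f x * Real.log (g x) ∂μ ≤
      ∫ x, (A⁻¹ * (f x * g x) + (Real.log A - 1) * f x) ∂μ := by
    refine integral_mono_ae hlog ((hint.const_mul _).add (hf.const_mul _)) ?_
    filter_upwards [hf0, hg0] with x h1 h2
    have h3 := Real.log_le_sub_one_of_pos (div_pos h2 hA)
    rw [Real.log_div h2.ne' hA.ne'] at h3
    have h4 := mul_le_mul_of_nonneg_left h3 h1
    have h5 : f x * (g x / A - 1) = A⁻¹ * (f x * g x) - f x := by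
      rw [div_eq_mul_inv]; ring
    linarith
  rw [integral_add (hint.const_mul _) (hf.const_mul _), integral_const_mul, integral_const_mul,
    hf1] at hb
  have h6 : A⁻¹ * ∫ x, f x * g x ∂μ ≤ 1 := by
    rw [inv_mul_le_iff₀ hA]; linarith
  linarith

theorem klDivergence_of_integrableOn
    (hi : IntegrableOn (fun x => f x * Real.log (f x / h x)) (Omega a b)) :
    klDivergence a b f h = ((∫ x in Omega a b, f x * Real.log (f x / h x) : ℝ) : EReal) := by
  rw [klDivergence, if_pos hi]

theorem klDivergence_of_not_integrableOn
    (hi : ¬ IntegrableOn (fun x => f x * Real.log (f x / h x)) (Omega a b)) :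
    klDivergence a b f h = ⊤ := by
  rw [klDivergence, if_neg hi]

theorem exp_klDivergence_ne_zero : EReal.exp (klDivergence a b f h) ≠ 0 := by
  rw [Ne, EReal.exp_eq_zero_iff, klDivergence]
  split_ifs <;> simp

theorem integrableOn_mul_log_ratio (hf : IsDensityOn a b f) (hh : IsDensityOn a b h)
    (hi : IntegrableOn (fun x => f x * Real.log (f x / h x)) (Omega a b)) :
    IntegrableOn (fun x => f x * Real.log (ratio α f h x)) (Omega a b) := by
  refine IntegrableOn.congr_fun (hi.const_mul α) (fun x hx => ?_) (measurableSet_Omega a b)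
  rw [log_ratio hf hh hx]
  ring

theorem setIntegral_mul_log_ratio (hf : IsDensityOn a b f) (hh : IsDensityOn a b h) :
    ∫ x in Omega a b, f x * Real.log (ratio α f h x) =
      α * ∫ x in Omega a b, f x * Real.log (f x / h x) := by
  rw [← integral_const_mul]
  refine setIntegral_congr_fun (measurableSet_Omega a b) fun x hx => ?_
  rw [log_ratio hf hh hx]
  ring

/-! ### The moment-entropy inequality -/

/-- An injective y vanishes at one point at most. Nonvanishing of the moment rules out 0 * ∞ when
the divergence is infinite. -/
theorem lintegral_abs_rpow_mul_ne_zero (hf : IsDensityOn a b f) (hh : IsDensityOn a b h)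
    (hy : IsChangeOfVar a b α f h y) (q : ℝ) :
    ∫⁻ x in Omega a b, ENNReal.ofReal (|y x| ^ q * f x) ≠ 0 := by
  intro h0
  have hc := hy.isPrimitiveOn.continuousOn (isOpen_Omega a b)
  have hO := measurableSet_Omega a b
  have hm : AEMeasurable (fun x => ENNReal.ofReal (|y x| ^ q * f x))
      (volume.restrict (Omega a b)) :=
    ((((hc.aemeasurable hO).abs).pow_const q).mul hf.measurable.aemeasurable).ennreal_ofReal
  rw [lintegral_eq_zero_iff' hm, Filter.EventuallyEq, ae_restrict_iff' hO] at h0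
  refine hf.volume_ne_zero ?_
  have hsub : (Omega a b ∩ y ⁻¹' {0}).Subsingleton := fun u hu v hv =>
    (hy.strictMonoOn hf hh).injOn hu.1 hv.1 ((mem_singleton_iff.1 hu.2).trans hv.2.symm)
  have hne := compl_mem_ae_iff.2 (hsub.measure_zero (μ := volume))
  have hall : ∀ᵐ x ∂(volume : Measure ℝ), x ∉ Omega a b := by
    filter_upwards [h0, hne] with x h1 h2 hx
    have h3 : y x ≠ 0 := fun h3 => h2 ⟨hx, h3⟩
    have h4 : 0 < |y x| ^ q * f x :=
      mul_pos (Real.rpow_pos_of_pos (abs_pos.2 h3) _) (hf.pos x hx)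
    exact absurd (h1 hx) (ENNReal.ofReal_pos.2 h4).ne'
  rw [ae_iff] at hall
  simpa using hall

/-- Jensen's inequality with exp(-c|y|^q) / r: multiplied by f = w r it becomes w exp(-c|y|^q),
which the change of variable integrates over the image of y. The parameter c is left free for
optimization. -/
theorem entropy_le_of_moment_lt_top (hf : IsDensityOn a b f) (hh : IsDensityOn a b h)
    (hy : IsChangeOfVar a b α f h y) {q c : ℝ} (hq : 0 < q) (hc : 0 < c)
    (hi : IntegrableOn (fun x => f x * Real.log (f x / h x)) (Omega a b))
    (hm : ∫⁻ x in Omega a b, ENNReal.ofReal (|y x| ^ q * f x) ≠ ⊤) :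
    -(c * (∫⁻ x in Omega a b, ENNReal.ofReal (|y x| ^ q * f x)).toReal) -
      α * ∫ x in Omega a b, f x * Real.log (f x / h x) ≤
        -1 / q * Real.log c + Real.log (partitionFn q) := by
  have hO := measurableSet_Omega a b
  have hyc := hy.isPrimitiveOn.continuousOn (isOpen_Omega a b)
  have hym : AEMeasurable y (volume.restrict (Omega a b)) := hyc.aemeasurable hO
  have hpm : AEMeasurable (fun x => |y x| ^ q) (volume.restrict (Omega a b)) :=
    hym.abs.pow_const q
  have hZ := partitionFn_pos hq
  have hpf : AEStronglyMeasurable (fun x => |y x| ^ q * f x) (volume.restrict (Omega a b)) :=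
    (hpm.mul hf.measurable.aemeasurable).aestronglyMeasurable
  have hpf0 : 0 ≤ᵐ[volume.restrict (Omega a b)] fun x => |y x| ^ q * f x :=
    Filter.Eventually.of_forall fun x => mul_nonneg (by positivity) (hf.nonneg x)
  have hint : IntegrableOn (fun x => |y x| ^ q * f x) (Omega a b) :=
    ⟨hpf, (hasFiniteIntegral_iff_ofReal hpf0).2 (lt_top_iff_ne_top.2 hm)⟩
  have hlr := integrableOn_mul_log_ratio (α := α) hf hh hi
  have hlog : EqOn (fun x => -c * (|y x| ^ q * f x) - f x * Real.log (ratio α f h x))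
      (fun x => f x * Real.log (Real.exp (-(c * |y x| ^ q)) / ratio α f h x)) (Omega a b) := by
    intro x hx
    dsimp only
    rw [Real.log_div (Real.exp_pos _).ne' (ratio_pos hf hh hx).ne', Real.log_exp]
    ring
  have key := integral_mul_log_le (μ := volume.restrict (Omega a b)) (f := f)
    (g := fun x => Real.exp (-(c * |y x| ^ q)) / ratio α f h x)
    (A := c ^ (-1 / q) * partitionFn q)
    (mul_pos (Real.rpow_pos_of_pos hc _) hZ) hf.integrableOn hf.setIntegral
    (Filter.Eventually.of_forall hf.nonneg)
    (by
      filter_upwards [ae_restrict_mem hO] with x hx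
      exact div_pos (Real.exp_pos _) (ratio_pos hf hh hx))
    ((Real.measurable_exp.comp_aemeasurable (hpm.const_mul c).neg).div
      (measurable_ratio hf hh).aemeasurable).aestronglyMeasurable
    (IntegrableOn.congr_fun ((hint.const_mul (-c)).sub hlr) hlog hO)
    (by
      have hk : Measurable fun t : ℝ => ENNReal.ofReal (Real.exp (-(c * |t| ^ q))) := by
        fun_prop
      rw [← lintegral_exp_neg_mul_abs_rpow hq hc]
      refine le_trans (le_of_eq ?_) (setLIntegral_le_lintegral (y '' Omega a b) _)
      rw [hy.isPrimitiveOn.lintegral_image (ordConnected_Omega a b) (isOpen_Omega a b)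
        (measurable_weight hf hh) (fun _ hx => weight_pos hf hh hx) hk.aemeasurable]
      refine setLIntegral_congr_fun hO fun x hx => ?_
      rw [← ENNReal.ofReal_mul (weight_pos hf hh hx).le]
      congr 1
      have := (ratio_pos (α := α) hf hh hx).ne'
      nth_rw 1 [← weight_mul_ratio (α := α) hf hh hx]
      field_simp)
  rw [← setIntegral_congr_fun hO hlog, integral_sub (hint.const_mul (-c)) hlr, integral_const_mul,
    setIntegral_mul_log_ratio hf hh, integral_eq_lintegral_of_nonneg_ae hpf0 hpf,
    Real.log_mul (Real.rpow_pos_of_pos hc _).ne' hZ.ne', Real.log_rpow hc] at key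
  linarith

theorem momentEntropyConst_rpow_le (hf : IsDensityOn a b f) (hh : IsDensityOn a b h)
    (hα : 0 < α) (hy : IsChangeOfVar a b α f h y) {q : ℝ} (hq : 0 < q) :
    momentEntropyConst q ^ (1 / α) ≤
      (∫⁻ x in Omega a b, ENNReal.ofReal (|y x| ^ q * f x)) ^ (1 / (q * α)) *
        EReal.exp (klDivergence a b f h) := by
  have hm0 := lintegral_abs_rpow_mul_ne_zero hf hh hy q
  have hexp : 0 < 1 / (q * α) := by positivity
  by_cases hi : IntegrableOn (fun x => f x * Real.log (f x / h x)) (Omega a b)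
  swap
  · rw [klDivergence_of_not_integrableOn hi, EReal.exp_top, ENNReal.mul_top]
    · exact le_top
    · exact fun h0 => hm0 ((ENNReal.rpow_eq_zero_iff_of_pos hexp).1 h0)
  by_cases hm : ∫⁻ x in Omega a b, ENNReal.ofReal (|y x| ^ q * f x) = ⊤
  · rw [hm, ENNReal.top_rpow_of_pos hexp, ENNReal.top_mul exp_klDivergence_ne_zero]
    exact le_top
  have hZ := partitionFn_pos hq
  set m := ∫⁻ x in Omega a b, ENNReal.ofReal (|y x| ^ q * f x) with hmdef
  have hM : 0 < m.toReal := ENNReal.toReal_pos hm0 hm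
  -- With m the moment, c = 1/(q m) minimizes c m - (1/q) log c, and makes c m = 1/q.
  have key := entropy_le_of_moment_lt_top hf hh hy hq
    (show 0 < (q * m.toReal)⁻¹ by positivity) hi hm
  rw [klDivergence_of_integrableOn hi, EReal.exp_coe, momentEntropyConst_eq hq,
    ← ENNReal.ofReal_toReal hm, ENNReal.ofReal_rpow_of_pos hM,
    ENNReal.ofReal_rpow_of_pos (by positivity), ← ENNReal.ofReal_mul (by positivity)]
  refine ENNReal.ofReal_le_ofReal ?_
  set D := ∫ x in Omega a b, f x * Real.log (f x / h x)
  rw [← hmdef, Real.log_inv, Real.log_mul hq.ne' hM.ne'] at key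
  rw [← Real.log_le_log_iff (by positivity) (by positivity),
    Real.log_mul (by positivity) (by positivity), Real.log_rpow (by positivity),
    Real.log_rpow hM, Real.log_exp, Real.log_div (by positivity) (by positivity),
    Real.log_rpow (by positivity), Real.log_mul hZ.ne' (by positivity), Real.log_exp,
    one_div q, Real.log_inv]
  have h1 : (q * m.toReal)⁻¹ * m.toReal = q⁻¹ := by field_simp
  rw [h1] at key
  have h2 : 1 / (q * α) * Real.log m.toReal + D = (1 / α) * (q⁻¹ * Real.log m.toReal + α * D) := by
    field_simp
  rw [h2]
  refine mul_le_mul_of_nonneg_left ?_ (by positivity)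
  have h3 : -1 / q = -q⁻¹ := by rw [neg_div, one_div]
  rw [h3] at key
  linarith

/-- An inner integral that diverges at x₀ diverges at every later point, and f has positive mass to
the right of x₀. -/
theorem canonicalRelCumMoment_eq_top (hf : IsDensityOn a b f) {q : ℝ} (hq : 0 < q) {x₀ : ℝ}
    (hx₀ : x₀ ∈ Omega a b)
    (htop : ∫⁻ s in Omega a (x₀ : EReal), ENNReal.ofReal (f s ^ (1 - α) * h s ^ α) = ⊤) :
    canonicalRelCumMoment a b q α f h = ⊤ := by
  obtain ⟨d, hd, hxd⟩ := exists_mem_gt (isOpen_Omega a b) hx₀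
  have hsub : Ioo x₀ d ⊆ Omega a b := fun x hx =>
    (ordConnected_Omega a b).out hx₀ hd (Ioo_subset_Icc_self hx)
  rw [canonicalRelCumMoment, eq_top_iff]
  refine le_trans ?_ (lintegral_mono_set hsub)
  rw [setLIntegral_congr_fun (g := fun _ => ⊤) measurableSet_Ioo, setLIntegral_const,
    ENNReal.top_mul]
  · simp [hxd]
  · intro x hx
    have h1 : Omega a (x₀ : EReal) ⊆ Omega a (x : EReal) := fun s hs =>
      ⟨hs.1, hs.2.trans (EReal.coe_lt_coe_iff.2 hx.1)⟩
    have h2 : ∫⁻ s in Omega a (x : EReal), ENNReal.ofReal (f s ^ (1 - α) * h s ^ α) = ⊤ :=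
      eq_top_iff.2 (htop ▸ lintegral_mono_set h1)
    dsimp only
    rw [h2, ENNReal.top_rpow_of_pos hq,
      ENNReal.top_mul (ENNReal.ofReal_pos.2 (hf.pos x (hsub hx))).ne']

theorem isChangeOfVar_canonical (hf : IsDensityOn a b f) (hh : IsDensityOn a b h)
    (hfin : ∀ x ∈ Omega a b,
      ∫⁻ s in Omega a (x : EReal), ENNReal.ofReal (f s ^ (1 - α) * h s ^ α) ≠ ⊤) :
    IsChangeOfVar a b α f h fun x =>
      (∫⁻ s in Omega a (x : EReal), ENNReal.ofReal (f s ^ (1 - α) * h s ^ α)).toReal := by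
  have main : ∀ x₁ ∈ Omega a b, ∀ x₂ ∈ Omega a b, x₁ ≤ x₂ →
      IntervalIntegrable (weight α f h) volume x₁ x₂ ∧
      (∫⁻ s in Omega a (x₂ : EReal), ENNReal.ofReal (weight α f h s)).toReal -
        (∫⁻ s in Omega a (x₁ : EReal), ENNReal.ofReal (weight α f h s)).toReal =
          ∫ s in x₁..x₂, weight α f h s := by
    intro x₁ h₁ x₂ h₂ hle
    have hunion : Omega a (x₂ : EReal) = Omega a (x₁ : EReal) ∪ Ico x₁ x₂ := by
      ext s
      constructor
      · rintro ⟨h3, h4⟩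
        rcases lt_or_ge s x₁ with h5 | h5
        · exact Or.inl ⟨h3, EReal.coe_lt_coe_iff.2 h5⟩
        · exact Or.inr ⟨h5, EReal.coe_lt_coe_iff.1 h4⟩
      · rintro (⟨h3, h4⟩ | ⟨h3, h4⟩)
        · exact ⟨h3, h4.trans_le (EReal.coe_le_coe_iff.2 hle)⟩
        · exact ⟨h₁.1.trans_le (EReal.coe_le_coe_iff.2 h3), EReal.coe_lt_coe_iff.2 h4⟩
    have hdisj : Disjoint (Omega a (x₁ : EReal)) (Ico x₁ x₂) :=
      disjoint_left.2 fun s hs hs' => (EReal.coe_lt_coe_iff.1 hs.2).not_ge hs'.1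
    have hsplit := lintegral_union (μ := volume)
      (f := fun s => ENNReal.ofReal (weight α f h s)) measurableSet_Ico hdisj
    rw [← hunion] at hsplit
    have hf₁ : ∫⁻ s in Omega a (x₁ : EReal), ENNReal.ofReal (weight α f h s) ≠ ⊤ := hfin x₁ h₁
    have hf₂ : ∫⁻ s in Omega a (x₂ : EReal), ENNReal.ofReal (weight α f h s) ≠ ⊤ := hfin x₂ h₂
    have hfI : ∫⁻ s in Ico x₁ x₂, ENNReal.ofReal (weight α f h s) ≠ ⊤ := fun h0 =>
      hf₂ (by rw [hsplit, h0, add_top])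
    have hnn : 0 ≤ᵐ[volume.restrict (Ioc x₁ x₂)] weight α f h := by
      filter_upwards [ae_restrict_mem measurableSet_Ioc] with s hs
      exact (weight_pos hf hh
        ((ordConnected_Omega a b).out h₁ h₂ (Ioc_subset_Icc_self hs))).le
    have hwm := (measurable_weight (α := α) hf hh).aestronglyMeasurable
      (μ := volume.restrict (Ioc x₁ x₂))
    have hIc : ∫⁻ s in Ico x₁ x₂, ENNReal.ofReal (weight α f h s) =
        ∫⁻ s in Ioc x₁ x₂, ENNReal.ofReal (weight α f h s) :=
      setLIntegral_congr Ico_ae_eq_Ioc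
    constructor
    · rw [intervalIntegrable_iff_integrableOn_Ioc_of_le hle]
      exact ⟨hwm, (hasFiniteIntegral_iff_ofReal hnn).2 (lt_top_iff_ne_top.2 (hIc ▸ hfI))⟩
    · rw [intervalIntegral.integral_of_le hle, integral_eq_lintegral_of_nonneg_ae hnn hwm, ← hIc,
        hsplit, ENNReal.toReal_add hf₁ hfI]
      ring
  intro x₁ h₁ x₂ h₂
  rcases le_total x₁ x₂ with hle | hle
  · exact main x₁ h₁ x₂ h₂ hle
  · obtain ⟨h3, h4⟩ := main x₂ h₂ x₁ h₁ hle
    refine ⟨h3.symm, ?_⟩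
    rw [intervalIntegral.integral_symm]
    exact (neg_sub _ _).symm.trans (congrArg Neg.neg h4)

/-- If every inner integral is finite, the canonical y is a genuine change of variable and the
general inequality applies; otherwise the right-hand side is infinite. -/
theorem momentEntropyConst_rpow_le_canonical (hf : IsDensityOn a b f) (hh : IsDensityOn a b h)
    (hα : 0 < α) {q : ℝ} (hq : 0 < q) :
    momentEntropyConst q ^ (1 / α) ≤
      canonicalRelCumDeviation a b q α f h * EReal.exp (klDivergence a b f h) := by
  by_cases hfin : ∀ x ∈ Omega a b,
      ∫⁻ s in Omega a (x : EReal), ENNReal.ofReal (f s ^ (1 - α) * h s ^ α) ≠ ⊤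
  · refine (momentEntropyConst_rpow_le hf hh hα (isChangeOfVar_canonical hf hh hfin)
      hq).trans_eq ?_
    rw [canonicalRelCumDeviation, canonicalRelCumMoment]
    congr 2
    refine setLIntegral_congr_fun (measurableSet_Omega a b) fun x hx => ?_
    rw [abs_of_nonneg ENNReal.toReal_nonneg, ENNReal.ofReal_mul (by positivity),
      ← ENNReal.ofReal_rpow_of_nonneg ENNReal.toReal_nonneg hq.le,
      ENNReal.ofReal_toReal (hfin x hx)]
  · push Not at hfin
    obtain ⟨x₀, hx₀, htop⟩ := hfin
    rw [canonicalRelCumDeviation, canonicalRelCumMoment_eq_top hf hq hx₀ htop,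
      ENNReal.top_rpow_of_pos (by positivity), ENNReal.top_mul exp_klDivergence_ne_zero]
    exact le_top

/-! ### The derivative of the transformed density -/

/-- `f^{α-1} h^{-α} |(log (f / h))'|`, whose `L^p(f)` norm is the relative Fisher divergence. -/
noncomputable def score (α : ℝ) (f h : ℝ → ℝ) (x : ℝ) : ℝ :=
  f x ^ (α - 1) * h x ^ (-α) * |deriv (fun t => Real.log (f t / h t)) x|

theorem score_nonneg (hf : IsDensityOn a b f) (hh : IsDensityOn a b h) (x : ℝ) :
    0 ≤ score α f h x :=
  mul_nonneg (mul_nonneg (Real.rpow_nonneg (hf.nonneg x) _) (Real.rpow_nonneg (hh.nonneg x) _))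
    (abs_nonneg _)

theorem measurable_score (hf : IsDensityOn a b f) (hh : IsDensityOn a b h) :
    Measurable (score α f h) :=
  ((hf.measurable.pow_const _).mul (hh.measurable.pow_const _)).mul (measurable_deriv _).abs

theorem relFisherDiv_eq (hf : IsDensityOn a b f) (hh : IsDensityOn a b h) (p : ℝ) (hp : 0 ≤ p) :
    relFisherDiv a b p α f h =
      ∫⁻ x in Omega a b, ENNReal.ofReal (f x) * ENNReal.ofReal (score α f h x) ^ p := by
  refine setLIntegral_congr_fun (measurableSet_Omega a b) fun x hx => ?_
  have h1 := hf.pos x hx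
  have h2 := hh.pos x hx
  rw [ENNReal.ofReal_rpow_of_nonneg (score_nonneg hf hh x) hp, ← ENNReal.ofReal_mul h1.le, score,
    Real.mul_rpow (by positivity) (abs_nonneg _), Real.mul_rpow (by positivity) (by positivity),
    ← Real.rpow_mul h1.le, ← Real.rpow_mul h2.le, Real.rpow_add h1, Real.rpow_one]
  congr 1
  rw [mul_comm p, neg_mul]
  ring

theorem hasDerivAt_ratio (hf : IsDensityOn a b f) (hh : IsDensityOn a b h)
    (hdf : DifferentiableOn ℝ f (Omega a b)) (hdh : DifferentiableOn ℝ h (Omega a b)) {x : ℝ}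
    (hx : x ∈ Omega a b) : HasDerivAt (ratio α f h)
      (ratio α f h x * (α * deriv (fun t => Real.log (f t / h t)) x)) x := by
  have hn := (isOpen_Omega a b).mem_nhds hx
  have hd : DifferentiableAt ℝ (fun t => Real.log (f t / h t)) x :=
    ((hdf.differentiableAt hn).div (hdh.differentiableAt hn) (hh.pos x hx).ne').log
      (div_pos (hf.pos x hx) (hh.pos x hx)).ne'
  have key : ∀ z ∈ Omega a b, ratio α f h z = Real.exp (α * Real.log (f z / h z)) := fun z hz => by
    rw [← log_ratio hf hh hz, Real.exp_log (ratio_pos hf hh hz)]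
  rw [key x hx]
  refine ((hd.hasDerivAt.const_mul α).exp).congr_of_eventuallyEq ?_
  filter_upwards [hn] with z hz using key z hz

/-- Here |r'| = α r |(log (f/h))'|, and r = f · f^(α-1) h^(-α). Dividing by w r = f, α times the
score is the modulus of the logarithmic derivative of the transformed density; this is the source of
the factor 1/α in the Stam constant. -/
theorem ofReal_abs_deriv_ratio (hf : IsDensityOn a b f) (hh : IsDensityOn a b h) (hα : 0 < α)
    (hdf : DifferentiableOn ℝ f (Omega a b)) (hdh : DifferentiableOn ℝ h (Omega a b)) {x : ℝ}
    (hx : x ∈ Omega a b) : ENNReal.ofReal |deriv (ratio α f h) x| =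
      ENNReal.ofReal α * (ENNReal.ofReal (f x) * ENNReal.ofReal (score α f h x)) := by
  have h1 := hf.pos x hx
  have h2 := hh.pos x hx
  rw [← ENNReal.ofReal_mul h1.le, ← ENNReal.ofReal_mul hα.le,
    (hasDerivAt_ratio hf hh hdf hdh hx).deriv, abs_mul, abs_mul, abs_of_pos hα,
    abs_of_pos (ratio_pos hf hh hx), score, ratio, Real.div_rpow h1.le h2.le, Real.rpow_sub h1,
    Real.rpow_one, Real.rpow_neg h2.le]
  congr 1
  field_simp

theorem lintegral_abs_deriv_ratio (hf : IsDensityOn a b f) (hh : IsDensityOn a b h) (hα : 0 < α)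
    (hdf : DifferentiableOn ℝ f (Omega a b)) (hdh : DifferentiableOn ℝ h (Omega a b)) :
    ∫⁻ x in Omega a b, ENNReal.ofReal |deriv (ratio α f h) x| =
      ENNReal.ofReal α * relFisherDiv a b 1 α f h := by
  rw [relFisherDiv_eq hf hh 1 zero_le_one, ← lintegral_const_mul' _ _ ENNReal.ofReal_ne_top]
  refine setLIntegral_congr_fun (measurableSet_Omega a b) fun x hx => ?_
  rw [ofReal_abs_deriv_ratio hf hh hα hdf hdh hx, ENNReal.rpow_one]

/-- Hölder's inequality for the derivative of the transformed density. -/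
theorem lintegral_abs_deriv_ratio_mul_le (hf : IsDensityOn a b f) (hh : IsDensityOn a b h)
    (hα : 0 < α) (hdf : DifferentiableOn ℝ f (Omega a b))
    (hdh : DifferentiableOn ℝ h (Omega a b)) {p q : ℝ} (hpq : p.HolderConjugate q) {k : ℝ → ℝ≥0∞}
    (hk : AEMeasurable k (volume.restrict (Omega a b))) :
    ∫⁻ x in Omega a b, ENNReal.ofReal |deriv (ratio α f h) x| * k x ≤
      ENNReal.ofReal α * (relFisherDiv a b p α f h ^ (1 / p) *
        (∫⁻ x in Omega a b, ENNReal.ofReal (f x) * k x ^ q) ^ (1 / q)) := by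
  -- Hölder is applied with respect to f dx, for which the p-th moment of the score is the relative
  -- Fisher divergence.
  set μ := (volume.restrict (Omega a b)).withDensity fun x => ENNReal.ofReal (f x) with hμ
  have hfm : Measurable fun x => ENNReal.ofReal (f x) := hf.measurable.ennreal_ofReal
  have hsm : Measurable fun x => ENNReal.ofReal (score α f h x) :=
    (measurable_score hf hh).ennreal_ofReal
  have hwd : ∀ g : ℝ → ℝ≥0∞, AEMeasurable g (volume.restrict (Omega a b)) →
      ∫⁻ x, g x ∂μ = ∫⁻ x in Omega a b, ENNReal.ofReal (f x) * g x := fun g hg => by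
    rw [hμ, lintegral_withDensity_eq_lintegral_mul₀ hfm.aemeasurable hg]
    rfl
  have hac : μ ≪ volume.restrict (Omega a b) := withDensity_absolutelyContinuous _ _
  have hold := ENNReal.lintegral_mul_le_Lp_mul_Lq μ hpq hsm.aemeasurable (hk.mono_ac hac)
  simp only [Pi.mul_apply] at hold
  rw [hwd (fun x => ENNReal.ofReal (score α f h x) * k x) (hsm.aemeasurable.mul hk),
    hwd (fun x => ENNReal.ofReal (score α f h x) ^ p) (hsm.aemeasurable.pow_const p),
    hwd (fun x => k x ^ q) (hk.pow_const q), ← relFisherDiv_eq hf hh p hpq.nonneg] at hold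
  refine le_trans (le_of_eq ?_) (mul_le_mul_right hold (ENNReal.ofReal α))
  rw [← lintegral_const_mul' _ _ ENNReal.ofReal_ne_top]
  refine setLIntegral_congr_fun (measurableSet_Omega a b) fun x hx => ?_
  rw [ofReal_abs_deriv_ratio hf hh hα hdf hdh hx]
  ring

/-- The case k = 1 of Hölder: a finite Fisher divergence gives r finite total variation. -/
theorem lintegral_abs_deriv_ratio_le (hf : IsDensityOn a b f) (hh : IsDensityOn a b h)
    (hα : 0 < α) (hdf : DifferentiableOn ℝ f (Omega a b))
    (hdh : DifferentiableOn ℝ h (Omega a b)) {p q : ℝ} (hpq : p.HolderConjugate q) :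
    ∫⁻ x in Omega a b, ENNReal.ofReal |deriv (ratio α f h) x| ≤
      ENNReal.ofReal α * relFisherDiv a b p α f h ^ (1 / p) := by
  have := lintegral_abs_deriv_ratio_mul_le hf hh hα hdf hdh hpq (k := fun _ => 1)
    aemeasurable_const
  simpa [hf.setLIntegral] using this

/-! ### Boundary behaviour and pointwise bounds -/

/-- Where r ≥ ε, the derivative w = f/r of y is at most f/ε, and f has mass 1. -/
theorem IsChangeOfVar.sub_le_of_ratio_ge (hf : IsDensityOn a b f) (hh : IsDensityOn a b h)
    (hy : IsChangeOfVar a b α f h y) {ε : ℝ} (hε : 0 < ε) {u v : ℝ} (hu : u ∈ Omega a b)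
    (hv : v ∈ Omega a b) (huv : u ≤ v) (hr : ∀ x ∈ Ioo u v, ε ≤ ratio α f h x) :
    y v - y u ≤ 1 / ε := by
  have hfi := hf.integrableOn
  have hsub : Icc u v ⊆ Omega a b := (ordConnected_Omega a b).out hu hv
  obtain ⟨hi, he⟩ := hy u hu v hv
  have hfI : IntegrableOn f (Ioo u v) := hfi.mono_set (Ioo_subset_Icc_self.trans hsub)
  rw [he, intervalIntegral.integral_of_le huv, integral_Ioc_eq_integral_Ioo]
  have hi' : IntegrableOn (weight α f h) (Ioo u v) :=
    ((intervalIntegrable_iff_integrableOn_Ioc_of_le huv).1 hi).mono_set Ioo_subset_Ioc_self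
  calc ∫ x in Ioo u v, weight α f h x ≤ ∫ x in Ioo u v, 1 / ε * f x := by
        refine setIntegral_mono_on hi' (hfI.const_mul _) measurableSet_Ioo fun x hx => ?_
        have hxO := hsub (Ioo_subset_Icc_self hx)
        rw [← weight_mul_ratio (α := α) hf hh hxO, one_div, inv_mul_eq_div, le_div_iff₀ hε]
        exact mul_le_mul_of_nonneg_left (hr x hx) (weight_pos hf hh hxO).le
    _ = 1 / ε * ∫ x in Ioo u v, f x := integral_const_mul _ _
    _ ≤ 1 / ε * ∫ x in Omega a b, f x := by
        refine mul_le_mul_of_nonneg_left ?_ (by positivity)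
        exact setIntegral_mono_set hfi (Filter.Eventually.of_forall hf.nonneg)
          (Ioo_subset_Icc_self.trans hsub).eventuallyLE
    _ = 1 / ε := by rw [hf.setIntegral, mul_one]

/-- If r ≥ ε everywhere to the right of x, then y is bounded above. Its supremum t is not attained,
so the transform vanishes at t, while it is at least ε at image points arbitrarily close to t. This
contradicts continuity. -/
theorem exists_ratio_lt_right (hf : IsDensityOn a b f) (hh : IsDensityOn a b h)
    (hy : IsChangeOfVar a b α f h y) (hc : Continuous (transform a b α f h y)) {ε : ℝ}
    (hε : 0 < ε) {x : ℝ} (hx : x ∈ Omega a b) : ∃ d ∈ Omega a b, x < d ∧ ratio α f h d < ε := by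
  by_contra! hcon
  have hm := hy.strictMonoOn hf hh
  have hbdd : BddAbove (y '' Omega a b) := by
    refine ⟨y x + 1 / ε, ?_⟩
    rintro _ ⟨v, hv, rfl⟩
    rcases le_total v x with hvx | hxv
    · have := hm.monotoneOn hv hx hvx
      have : 0 < 1 / ε := by positivity
      linarith
    · have := hy.sub_le_of_ratio_ge hf hh hε hx hv hxv fun z hz =>
        hcon z ((ordConnected_Omega a b).out hx hv (Ioo_subset_Icc_self hz)) hz.1
      linarith
  set t := sSup (y '' Omega a b) with ht
  have hlt : ∀ v ∈ Omega a b, y v < t := fun v hv => by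
    obtain ⟨d, hd, hvd⟩ := exists_mem_gt (isOpen_Omega a b) hv
    exact (hm hv hd hvd).trans_le (le_csSup hbdd (mem_image_of_mem y hd))
  have ht0 : transform a b α f h y t = 0 :=
    transform_of_notMem fun ⟨v, hv, hvt⟩ => (hlt v hv).ne hvt
  have hmem : t ∈ closure (y '' Omega a b) := csSup_mem_closure (hf.nonempty.image y) hbdd
  have hopen : IsOpen ({s | transform a b α f h y s < ε} ∩ Ioi (y x)) :=
    (isOpen_lt hc continuous_const).inter isOpen_Ioi
  obtain ⟨_, ⟨h1, h2⟩, d, hd, rfl⟩ := mem_closure_iff.1 hmem _ hopen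
    ⟨by simpa [ht0] using hε, hlt x hx⟩
  rw [mem_ofPred_eq, transform_apply hf hh hy hd] at h1
  exact h1.not_ge (hcon d hd ((hm.lt_iff_lt hx hd).1 h2))

theorem exists_ratio_lt_left (hf : IsDensityOn a b f) (hh : IsDensityOn a b h)
    (hy : IsChangeOfVar a b α f h y) (hc : Continuous (transform a b α f h y)) {ε : ℝ}
    (hε : 0 < ε) {x : ℝ} (hx : x ∈ Omega a b) : ∃ d ∈ Omega a b, d < x ∧ ratio α f h d < ε := by
  by_contra! hcon
  have hm := hy.strictMonoOn hf hh
  have hbdd : BddBelow (y '' Omega a b) := by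
    refine ⟨y x - 1 / ε, ?_⟩
    rintro _ ⟨v, hv, rfl⟩
    rcases le_total x v with hvx | hxv
    · have := hm.monotoneOn hx hv hvx
      have : 0 < 1 / ε := by positivity
      linarith
    · have := hy.sub_le_of_ratio_ge hf hh hε hv hx hxv fun z hz =>
        hcon z ((ordConnected_Omega a b).out hv hx (Ioo_subset_Icc_self hz)) hz.2
      linarith
  set t := sInf (y '' Omega a b) with ht
  have hlt : ∀ v ∈ Omega a b, t < y v := fun v hv => by
    obtain ⟨d, hd, hvd⟩ := exists_mem_lt (isOpen_Omega a b) hv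
    exact (csInf_le hbdd (mem_image_of_mem y hd)).trans_lt (hm hd hv hvd)
  have ht0 : transform a b α f h y t = 0 :=
    transform_of_notMem fun ⟨v, hv, hvt⟩ => (hlt v hv).ne' hvt
  have hmem : t ∈ closure (y '' Omega a b) := csInf_mem_closure (hf.nonempty.image y) hbdd
  have hopen : IsOpen ({s | transform a b α f h y s < ε} ∩ Iio (y x)) :=
    (isOpen_lt hc continuous_const).inter isOpen_Iio
  obtain ⟨_, ⟨h1, h2⟩, d, hd, rfl⟩ := mem_closure_iff.1 hmem _ hopen
    ⟨by simpa [ht0] using hε, hlt x hx⟩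
  rw [mem_ofPred_eq, transform_apply hf hh hy hd] at h1
  exact h1.not_ge (hcon d hd ((hm.lt_iff_lt hd hx).1 h2))

theorem ofReal_abs_sub_le_lintegral_deriv {F : ℝ → ℝ} {u v : ℝ} (huv : u ≤ v)
    (hd : ∀ x ∈ Icc u v, DifferentiableAt ℝ F x) :
    ENNReal.ofReal |F v - F u| ≤ ∫⁻ x in Ioo u v, ENNReal.ofReal |deriv F x| := by
  by_cases htop : ∫⁻ x in Ioo u v, ENNReal.ofReal |deriv F x| = ⊤
  · rw [htop]; exact le_top
  have hm : AEStronglyMeasurable (deriv F) (volume.restrict (Ioo u v)) :=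
    (measurable_deriv F).aestronglyMeasurable
  have hint : IntegrableOn (deriv F) (Ioo u v) := by
    refine ⟨hm, (hasFiniteIntegral_iff_norm _).2 ?_⟩
    simpa [Real.norm_eq_abs] using lt_top_iff_ne_top.2 htop
  have hii : IntervalIntegrable (deriv F) volume u v :=
    (intervalIntegrable_iff_integrableOn_Ioo_of_le huv).2 hint
  have hftc := intervalIntegral.integral_eq_sub_of_hasDerivAt
    (fun x hx => (hd x (uIcc_of_le huv ▸ hx)).hasDerivAt) hii
  rw [← hftc, intervalIntegral.integral_of_le huv, integral_Ioc_eq_integral_Ioo,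
    ← ofReal_integral_eq_lintegral_ofReal hint.abs (Filter.Eventually.of_forall fun _ => abs_nonneg _)]
  exact ENNReal.ofReal_le_ofReal (abs_integral_le_integral_abs)

/-- Some d > x in Ω has r(d) < ε, so r(x) exceeds the variation of r on (x, d) by less than ε. -/
theorem ratio_le_lintegral_right (hf : IsDensityOn a b f) (hh : IsDensityOn a b h)
    (hdf : DifferentiableOn ℝ f (Omega a b)) (hdh : DifferentiableOn ℝ h (Omega a b))
    (hy : IsChangeOfVar a b α f h y) (hc : Continuous (transform a b α f h y)) {x : ℝ}
    (hx : x ∈ Omega a b) : ENNReal.ofReal (ratio α f h x) ≤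
      ∫⁻ s in Omega a b ∩ Ioi x, ENNReal.ofReal |deriv (ratio α f h) s| := by
  refine ENNReal.le_of_forall_pos_le_add fun ε hε _ => ?_
  obtain ⟨d, hd, hxd, hlt⟩ := exists_ratio_lt_right hf hh hy hc (NNReal.coe_pos.2 hε) hx
  have hsub := (ordConnected_Omega a b).out hx hd
  have h1 := ofReal_abs_sub_le_lintegral_deriv hxd.le fun z hz =>
    (hasDerivAt_ratio (α := α) hf hh hdf hdh (hsub hz)).differentiableAt
  have h2 : Ioo x d ⊆ Omega a b ∩ Ioi x := fun z hz => ⟨hsub (Ioo_subset_Icc_self hz), hz.1⟩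
  calc ENNReal.ofReal (ratio α f h x)
      ≤ ENNReal.ofReal (|ratio α f h d - ratio α f h x| + ε) := by
        refine ENNReal.ofReal_le_ofReal ?_
        have := neg_abs_le (ratio α f h d - ratio α f h x)
        linarith
    _ = ENNReal.ofReal |ratio α f h d - ratio α f h x| + ε := by
        rw [ENNReal.ofReal_add (abs_nonneg _) ε.coe_nonneg, ENNReal.ofReal_coe_nnreal]
    _ ≤ _ := by gcongr; exact h1.trans (lintegral_mono_set h2)

theorem ratio_le_lintegral_left (hf : IsDensityOn a b f) (hh : IsDensityOn a b h)
    (hdf : DifferentiableOn ℝ f (Omega a b)) (hdh : DifferentiableOn ℝ h (Omega a b))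
    (hy : IsChangeOfVar a b α f h y) (hc : Continuous (transform a b α f h y)) {x : ℝ}
    (hx : x ∈ Omega a b) : ENNReal.ofReal (ratio α f h x) ≤
      ∫⁻ s in Omega a b ∩ Iio x, ENNReal.ofReal |deriv (ratio α f h) s| := by
  refine ENNReal.le_of_forall_pos_le_add fun ε hε _ => ?_
  obtain ⟨d, hd, hxd, hlt⟩ := exists_ratio_lt_left hf hh hy hc (NNReal.coe_pos.2 hε) hx
  have hsub := (ordConnected_Omega a b).out hd hx
  have h1 := ofReal_abs_sub_le_lintegral_deriv hxd.le fun z hz =>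
    (hasDerivAt_ratio (α := α) hf hh hdf hdh (hsub hz)).differentiableAt
  have h2 : Ioo d x ⊆ Omega a b ∩ Iio x := fun z hz => ⟨hsub (Ioo_subset_Icc_self hz), hz.2⟩
  calc ENNReal.ofReal (ratio α f h x)
      ≤ ENNReal.ofReal (|ratio α f h x - ratio α f h d| + ε) := by
        refine ENNReal.ofReal_le_ofReal ?_
        have := le_abs_self (ratio α f h x - ratio α f h d)
        linarith
    _ = ENNReal.ofReal |ratio α f h x - ratio α f h d| + ε := by
        rw [ENNReal.ofReal_add (abs_nonneg _) ε.coe_nonneg, ENNReal.ofReal_coe_nnreal]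
    _ ≤ _ := by gcongr; exact h1.trans (lintegral_mono_set h2)

/-- The total variation contains a climb to r(x) on the left and a descent from it on the right. The
factor 2 gives the constant for p = 1. -/
theorem two_mul_ratio_le (hf : IsDensityOn a b f) (hh : IsDensityOn a b h)
    (hdf : DifferentiableOn ℝ f (Omega a b)) (hdh : DifferentiableOn ℝ h (Omega a b))
    (hy : IsChangeOfVar a b α f h y) (hc : Continuous (transform a b α f h y)) {x : ℝ}
    (hx : x ∈ Omega a b) : 2 * ENNReal.ofReal (ratio α f h x) ≤
      ∫⁻ s in Omega a b, ENNReal.ofReal |deriv (ratio α f h) s| := by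
  have h1 := ratio_le_lintegral_right hf hh hdf hdh hy hc hx
  have h2 := ratio_le_lintegral_left hf hh hdf hdh hy hc hx
  rw [two_mul]
  refine (add_le_add h1 h2).trans ?_
  rw [← lintegral_union ((measurableSet_Omega a b).inter measurableSet_Iio)]
  · exact lintegral_mono_set (union_subset inter_subset_left inter_subset_left)
  · exact disjoint_left.2 fun s hs hs' => lt_asymm (mem_Ioi.1 hs.2) (mem_Iio.1 hs'.2)

/-- If the transformed density is bounded, then the divergence is finite. -/
theorem integrableOn_mul_log_div (hf : IsDensityOn a b f) (hh : IsDensityOn a b h) (hα : 0 < α)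
    {M : ℝ} (hM : ∀ x ∈ Omega a b, ratio α f h x ≤ M) :
    IntegrableOn (fun x => f x * Real.log (f x / h x)) (Omega a b) := by
  -- The bound on r controls the integrand from above; from below, f log (f/h) ≥ f - h ≥ -h.
  have hb : IntegrableOn (fun x => h x + |Real.log M / α| * f x) (Omega a b) :=
    Integrable.add hh.integrableOn (hf.integrableOn.const_mul _)
  refine Integrable.mono' hb (hf.measurable.mul
    (Real.measurable_log.comp (hf.measurable.div hh.measurable))).aestronglyMeasurable ?_
  filter_upwards [ae_restrict_mem (measurableSet_Omega a b)] with x hx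
  have h1 := hf.pos x hx
  have h2 := hh.pos x hx
  have h3 := hM x hx
  have h4 : Real.log (f x / h x) ≤ Real.log M / α := by
    rw [le_div_iff₀ hα, mul_comm, ← log_ratio hf hh hx]
    exact Real.log_le_log (ratio_pos hf hh hx) h3
  have h5 : f x * Real.log (f x / h x) ≤ |Real.log M / α| * f x := by
    rw [mul_comm]
    exact mul_le_mul_of_nonneg_right (h4.trans (le_abs_self _)) h1.le
  have h6 : -h x ≤ f x * Real.log (f x / h x) := by
    have h7 := Real.log_le_sub_one_of_pos (div_pos h2 h1)
    have h8 : Real.log (f x / h x) = -Real.log (h x / f x) := by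
      rw [← Real.log_inv, inv_div]
    have h9 := mul_le_mul_of_nonneg_left h7 h1.le
    have h10 : f x * (h x / f x - 1) = h x - f x := by field_simp
    rw [h8]
    linarith
  have h11 : 0 ≤ |Real.log M / α| * f x := by positivity
  rw [Real.norm_eq_abs, abs_le]
  constructor <;> linarith

/-! ### Monotone transport to a stretched Gaussian -/

/-- The cumulative function `x ↦ ∫_{-∞}^x g`. -/
noncomputable def cumul (g : ℝ → ℝ) (x : ℝ) : ℝ := ∫ s in Iic x, g s

theorem cumul_sub_cumul {g : ℝ → ℝ} (hg : Integrable g) (x z : ℝ) :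
    cumul g z - cumul g x = ∫ s in x..z, g s :=
  intervalIntegral.integral_Iic_sub_Iic hg.integrableOn hg.integrableOn

theorem hasStrictDerivAt_cumul {g : ℝ → ℝ} (hg : Integrable g) {x : ℝ} (hx : ContinuousAt g x) :
    HasStrictDerivAt (cumul g) (g x) x := by
  have h1 : HasStrictDerivAt (fun z => cumul g x + ∫ s in x..z, g s) (g x) x :=
    (intervalIntegral.integral_hasStrictDerivAt_right hg.intervalIntegrable
      hg.aestronglyMeasurable.stronglyMeasurableAtFilter hx).const_add _
  refine h1.congr_of_eventuallyEq (Filter.Eventually.of_forall fun z => ?_)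
  have := cumul_sub_cumul hg x z
  dsimp only
  linarith

theorem cumul_stretchedGaussian_strictMono {q : ℝ} (hq : 0 < q) :
    StrictMono (cumul (stretchedGaussian q)) := by
  intro x z hxz
  have h1 := cumul_sub_cumul (integrable_stretchedGaussian hq) x z
  have h2 := intervalIntegral.intervalIntegral_pos_of_pos_on
    (integrable_stretchedGaussian hq).intervalIntegrable
    (fun t _ => stretchedGaussian_pos hq t) hxz
  linarith

theorem mem_range_cumul_stretchedGaussian {q : ℝ} (hq : 0 < q) {v : ℝ} (hv : v ∈ Ioo (0 : ℝ) 1) :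
    v ∈ range (cumul (stretchedGaussian q)) := by
  have hi := integrable_stretchedGaussian hq
  have hcont : Continuous (cumul (stretchedGaussian q)) := continuous_iff_continuousAt.2 fun x =>
    (hasStrictDerivAt_cumul hi (continuous_stretchedGaussian hq).continuousAt).hasDerivAt.continuousAt
  have htop : Filter.Tendsto (cumul (stretchedGaussian q)) Filter.atTop (nhds 1) := by
    have h1 := (intervalIntegral_tendsto_integral_Ioi 0 hi.integrableOn
      Filter.tendsto_id).const_add (cumul (stretchedGaussian q) 0)
    have h2 : cumul (stretchedGaussian q) 0 + ∫ x in Ioi 0, stretchedGaussian q x = 1 := by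
      rw [cumul, ← integral_stretchedGaussian hq, ← compl_Iic]
      exact integral_add_compl measurableSet_Iic hi
    rw [h2] at h1
    refine h1.congr fun x => ?_
    have := cumul_sub_cumul hi 0 x
    simp only [id]
    linarith
  have hbot : Filter.Tendsto (cumul (stretchedGaussian q)) Filter.atBot (nhds 0) := by
    have h1 := (intervalIntegral_tendsto_integral_Iic 0 hi.integrableOn
      Filter.tendsto_id).const_sub (cumul (stretchedGaussian q) 0)
    have h2 : cumul (stretchedGaussian q) 0 - ∫ x in Iic 0, stretchedGaussian q x = 0 := sub_self _
    rw [h2] at h1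
    refine h1.congr fun x => ?_
    have := cumul_sub_cumul hi x 0
    simp only [id]
    linarith
  obtain ⟨c, hc⟩ := (hbot.eventually (gt_mem_nhds hv.1)).exists
  obtain ⟨d, hd⟩ := (htop.eventually (lt_mem_nhds hv.2)).exists
  exact mem_range_of_exists_le_of_exists_ge hcont ⟨c, hc.le⟩ ⟨d, hd.le⟩

theorem IsDensityOn.integrable (hf : IsDensityOn a b f) : Integrable f := by
  refine ⟨hf.measurable.aestronglyMeasurable, ?_⟩
  rw [hasFiniteIntegral_iff_ofReal (Filter.Eventually.of_forall hf.nonneg), hf.lintegral_eq_one]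
  exact ENNReal.one_lt_top

theorem IsDensityOn.cumul_mem_Ioo (hf : IsDensityOn a b f) {x : ℝ} (hx : x ∈ Omega a b) :
    cumul f x ∈ Ioo (0 : ℝ) 1 := by
  have hpos : ∀ u ∈ Omega a b, ∀ v ∈ Omega a b, u < v → cumul f u < cumul f v := by
    intro u hu v hv huv
    have h1 := intervalIntegral.intervalIntegral_pos_of_pos_on hf.integrable.intervalIntegrable
      (fun t ht => hf.pos t ((ordConnected_Omega a b).out hu hv (Ioo_subset_Icc_self ht))) huv
    have h2 := cumul_sub_cumul hf.integrable u v
    linarith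
  have hone : ∫ t, f t = 1 := by
    rw [integral_eq_lintegral_of_nonneg_ae (Filter.Eventually.of_forall hf.nonneg)
      hf.measurable.aestronglyMeasurable, hf.lintegral_eq_one, ENNReal.toReal_one]
  obtain ⟨c, hc, hcx⟩ := exists_mem_lt (isOpen_Omega a b) hx
  obtain ⟨d, hd, hxd⟩ := exists_mem_gt (isOpen_Omega a b) hx
  constructor
  · exact (integral_nonneg hf.nonneg).trans_lt (hpos c hc x hx hcx)
  · refine (hpos x hx d hd hxd).trans_le ?_
    rw [← hone]
    exact setIntegral_le_integral hf.integrable (Filter.Eventually.of_forall hf.nonneg)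

/-- T is the inverse cumulative function of the stretched Gaussian composed with the cumulative
function of f. Continuity of f makes the latter differentiable at each point of Ω. -/
theorem exists_transport (hf : IsDensityOn a b f) (hc : ContinuousOn f (Omega a b)) {q : ℝ}
    (hq : 0 < q) :
    ∃ T : ℝ → ℝ, ∀ x ∈ Omega a b, HasDerivAt T (f x / stretchedGaussian q (T x)) x := by
  have hi := integrable_stretchedGaussian hq
  have hinj := (cumul_stretchedGaussian_strictMono hq).injective
  refine ⟨fun x => Function.invFun (cumul (stretchedGaussian q)) (cumul f x), fun x hx => ?_⟩
  obtain ⟨t, ht⟩ := mem_range_cumul_stretchedGaussian hq (hf.cumul_mem_Ioo hx)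
  have h1 := (hasStrictDerivAt_cumul hi
    (continuous_stretchedGaussian hq).continuousAt (x := t)).to_local_left_inverse
    (stretchedGaussian_pos hq t).ne'
    (Filter.Eventually.of_forall (Function.leftInverse_invFun hinj))
  have h2 := (hasStrictDerivAt_cumul hf.integrable
    (hc.continuousAt ((isOpen_Omega a b).mem_nhds hx))).hasDerivAt
  rw [ht] at h1
  have h3 := h1.hasDerivAt.comp x h2
  have h4 : Function.invFun (cumul (stretchedGaussian q)) (cumul f x) = t := by
    rw [← ht]; exact Function.leftInverse_invFun hinj t
  dsimp only
  rw [h4, div_eq_inv_mul]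
  exact h3

section Transport

variable {q : ℝ} {T : ℝ → ℝ}

theorem strictMonoOn_transport (hf : IsDensityOn a b f) (hq : 0 < q)
    (hT : ∀ x ∈ Omega a b, HasDerivAt T (f x / stretchedGaussian q (T x)) x) :
    StrictMonoOn T (Omega a b) := by
  refine strictMonoOn_of_deriv_pos (ordConnected_Omega a b).convex
    (fun x hx => (hT x hx).continuousAt.continuousWithinAt) fun x hx => ?_
  have hx' := interior_subset hx
  rw [(hT x hx').deriv]
  exact div_pos (hf.pos x hx') (stretchedGaussian_pos hq _)

theorem setLIntegral_image_transport (hf : IsDensityOn a b f) (hq : 0 < q)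
    (hT : ∀ x ∈ Omega a b, HasDerivAt T (f x / stretchedGaussian q (T x)) x) (k : ℝ → ℝ≥0∞) :
    ∫⁻ t in T '' Omega a b, k t * ENNReal.ofReal (stretchedGaussian q t) =
      ∫⁻ x in Omega a b, k (T x) * ENNReal.ofReal (f x) := by
  rw [lintegral_image_eq_lintegral_abs_deriv_mul (measurableSet_Omega a b)
    (fun x hx => (hT x hx).hasDerivWithinAt) (strictMonoOn_transport hf hq hT).injOn]
  refine setLIntegral_congr_fun (measurableSet_Omega a b) fun x hx => ?_
  have hG := stretchedGaussian_pos hq (T x)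
  rw [abs_of_nonneg (div_nonneg (hf.nonneg x) hG.le), mul_left_comm,
    ← ENNReal.ofReal_mul (div_nonneg (hf.nonneg x) hG.le), div_mul_cancel₀ _ hG.ne']

/-- The Gaussian mass of the image is the mass of f, namely 1. Nothing is left for the complement,
and the Gaussian is positive everywhere. -/
theorem measure_compl_image_transport (hf : IsDensityOn a b f) (hq : 0 < q)
    (hT : ∀ x ∈ Omega a b, HasDerivAt T (f x / stretchedGaussian q (T x)) x) :
    volume (T '' Omega a b)ᶜ = 0 := by
  have hJ : MeasurableSet (T '' Omega a b) :=
    ((ordConnected_Omega a b).isPreconnected.image T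
      fun x hx => (hT x hx).continuousAt.continuousWithinAt).ordConnected.measurableSet
  have hGm : Measurable fun t => ENNReal.ofReal (stretchedGaussian q t) :=
    (continuous_stretchedGaussian hq).measurable.ennreal_ofReal
  have h1 : ∫⁻ t in T '' Omega a b, ENNReal.ofReal (stretchedGaussian q t) = 1 := by
    simpa [hf.setLIntegral] using setLIntegral_image_transport hf hq hT fun _ => 1
  have h2 : ∫⁻ t, ENNReal.ofReal (stretchedGaussian q t) = 1 := by
    rw [← ofReal_integral_eq_lintegral_ofReal (integrable_stretchedGaussian hq)
      (Filter.Eventually.of_forall fun t => (stretchedGaussian_pos hq t).le),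
      integral_stretchedGaussian hq, ENNReal.ofReal_one]
  have h3 := lintegral_add_compl (μ := volume)
    (fun t => ENNReal.ofReal (stretchedGaussian q t)) hJ
  rw [h1, h2] at h3
  have h4 : ∫⁻ t in (T '' Omega a b)ᶜ, ENNReal.ofReal (stretchedGaussian q t) = 0 :=
    (ENNReal.add_right_inj ENNReal.one_ne_top).1 (h3.trans (add_zero _).symm)
  rw [lintegral_eq_zero_iff hGm] at h4
  by_contra h5
  have : NeZero (volume.restrict (T '' Omega a b)ᶜ) :=
    ⟨fun h6 => h5 (Measure.restrict_eq_zero.1 h6)⟩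
  obtain ⟨t, ht⟩ := h4.exists
  exact (ENNReal.ofReal_pos.2 (stretchedGaussian_pos hq t)).ne' ht

theorem lintegral_transport (hf : IsDensityOn a b f) (hq : 0 < q)
    (hT : ∀ x ∈ Omega a b, HasDerivAt T (f x / stretchedGaussian q (T x)) x) (k : ℝ → ℝ≥0∞) :
    ∫⁻ t, k t * ENNReal.ofReal (stretchedGaussian q t) =
      ∫⁻ x in Omega a b, k (T x) * ENNReal.ofReal (f x) := by
  rw [← setLIntegral_image_transport hf hq hT k, Measure.restrict_eq_self_of_ae_mem]
  exact mem_ae_iff.2 (measure_compl_image_transport hf hq hT)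

theorem lintegral_abs_transport_rpow (hf : IsDensityOn a b f) (hq : 0 < q)
    (hT : ∀ x ∈ Omega a b, HasDerivAt T (f x / stretchedGaussian q (T x)) x) :
    ∫⁻ x in Omega a b, ENNReal.ofReal (|T x| ^ q * f x) = ENNReal.ofReal (1 / q) := by
  rw [← absMoment_stretchedGaussian hq, absMoment]
  have h1 := lintegral_transport hf hq hT fun t => ENNReal.ofReal (|t| ^ q)
  have h2 : ∀ t z : ℝ, ENNReal.ofReal (|t| ^ q) * ENNReal.ofReal z = ENNReal.ofReal (|t| ^ q * z) :=
    fun t z => (ENNReal.ofReal_mul (by positivity)).symm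
  simp_rw [h2] at h1
  exact h1.symm

/-- An interval of full measure meets both half-lines. The zero of T is the base point for the
integration by parts. -/
theorem exists_transport_eq_zero (hf : IsDensityOn a b f) (hq : 0 < q)
    (hT : ∀ x ∈ Omega a b, HasDerivAt T (f x / stretchedGaussian q (T x)) x) :
    ∃ x ∈ Omega a b, T x = 0 := by
  have hJ : (T '' Omega a b).OrdConnected :=
    ((ordConnected_Omega a b).isPreconnected.image T
      fun x hx => (hT x hx).continuousAt.continuousWithinAt).ordConnected
  have h0 := measure_compl_image_transport hf hq hT
  have hmeet : ∀ s : Set ℝ, volume s ≠ 0 → ∃ t ∈ s, t ∈ T '' Omega a b := by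
    intro s hs
    by_contra! hcon
    exact hs (measure_mono_null (fun t ht => hcon t ht) h0)
  obtain ⟨t₁, h1, h1'⟩ := hmeet (Iio 0) (by simp)
  obtain ⟨t₂, h2, h2'⟩ := hmeet (Ioi 0) (by simp)
  exact hJ.out h1' h2' ⟨le_of_lt h1, le_of_lt h2⟩

end Transport

/-- Integration by parts in the form of Tonelli's theorem: if `R` is bounded by the mass of `v`
beyond `x`, as seen from the zero `x₀` of `T`, then `∫ T' R ≤ ∫ |T| v`. -/
theorem lintegral_deriv_mul_le {s : Set ℝ} (hs : s.OrdConnected) {T T' : ℝ → ℝ} {R v : ℝ → ℝ≥0∞}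
    {x₀ : ℝ} (hx₀ : x₀ ∈ s) (hT0 : T x₀ = 0) (hmono : StrictMonoOn T s)
    (hT : ∀ x ∈ s, HasDerivAt T (T' x) x) (hT' : ∀ x ∈ s, 0 ≤ T' x)
    (hTm : AEMeasurable T' (volume.restrict s)) (hv : Measurable v)
    (hR : ∀ x ∈ s, R x ≤ ∫⁻ t in s ∩ Ioi x, v t)
    (hL : ∀ x ∈ s, R x ≤ ∫⁻ t in s ∩ Iio x, v t) :
    ∫⁻ x in s, ENNReal.ofReal (T' x) * R x ≤ ∫⁻ t in s, ENNReal.ofReal |T t| * v t := by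
  have hsm := hs.measurableSet
  -- For fixed x, the t-section of K is the tail beyond x on the side away from x₀, whose mass
  -- bounds R x. For fixed t, the x-section is the segment between x₀ and t, whose T'-mass is at
  -- most |T t|. Tonelli exchanges the two descriptions.
  set K : Set (ℝ × ℝ) := {z | (x₀ ≤ z.1 ∧ z.1 < z.2) ∨ (z.2 < z.1 ∧ z.1 < x₀)} with hK
  have hKm : MeasurableSet K :=
    ((measurableSet_le measurable_const measurable_fst).inter
      (measurableSet_lt measurable_fst measurable_snd)).union
    ((measurableSet_lt measurable_snd measurable_fst).inter
      (measurableSet_lt measurable_fst measurable_const))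
  have hKv : Measurable (K.indicator fun z => v z.2) := (hv.comp measurable_snd).indicator hKm
  have h1 : ∀ x ∈ s, R x ≤ ∫⁻ t in s, K.indicator (fun z => v z.2) (x, t) := by
    intro x hx
    rcases le_or_gt x₀ x with hle | hlt
    · refine (hR x hx).trans_eq ?_
      rw [inter_comm, ← Measure.restrict_restrict measurableSet_Ioi,
        ← lintegral_indicator measurableSet_Ioi]
      refine lintegral_congr fun t => ?_
      simp only [indicator, hK, mem_Ioi, mem_ofPred_eq, hle, true_and, hle.not_gt, and_false,
        or_false]
    · refine (hL x hx).trans_eq ?_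
      rw [inter_comm, ← Measure.restrict_restrict measurableSet_Iio,
        ← lintegral_indicator measurableSet_Iio]
      refine lintegral_congr fun t => ?_
      simp only [indicator, hK, mem_Iio, mem_ofPred_eq, hlt, and_true, hlt.not_ge, false_and,
        false_or]
  -- The T'-mass of u is the length of its image, by change of variables for the injective map T.
  have hmeas : ∀ u ⊆ s, MeasurableSet u →
      ∫⁻ x in u, ENNReal.ofReal (T' x) = volume (T '' u) := by
    intro u hu hum
    have := lintegral_image_eq_lintegral_abs_deriv_mul hum
      (fun x hx => (hT x (hu hx)).hasDerivWithinAt) (hmono.injOn.mono hu) fun _ => 1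
    simp only [lintegral_const, Measure.restrict_apply_univ, one_mul, mul_one] at this
    rw [this]
    exact setLIntegral_congr_fun hum fun x hx => by rw [abs_of_nonneg (hT' x (hu hx))]
  have h2 : ∀ t ∈ s, ∫⁻ x in s, ENNReal.ofReal (T' x) * K.indicator (fun z => v z.2) (x, t) ≤
      ENNReal.ofReal |T t| * v t := by
    intro t ht
    have h3 : ∀ u ⊆ s, MeasurableSet u → (∀ x, (x, t) ∈ K ↔ x ∈ u) →
        T '' u ⊆ uIcc 0 (T t) →
        ∫⁻ x in s, ENNReal.ofReal (T' x) * K.indicator (fun z => v z.2) (x, t) ≤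
          ENNReal.ofReal |T t| * v t := by
      intro u hu hum hiff himg
      have h4 : ∀ x, ENNReal.ofReal (T' x) * K.indicator (fun z => v z.2) (x, t) =
          u.indicator (fun x => ENNReal.ofReal (T' x) * v t) x := fun x => by
        by_cases hx : x ∈ u
        · rw [indicator_of_mem hx, indicator_of_mem ((hiff x).2 hx)]
        · rw [indicator_of_notMem hx, indicator_of_notMem fun h => hx ((hiff x).1 h), mul_zero]
      simp_rw [h4]
      rw [lintegral_indicator hum, Measure.restrict_restrict hum, inter_eq_left.2 hu,
        lintegral_mul_const'' _ ((hTm.mono_measure (Measure.restrict_mono hu le_rfl)).ennreal_ofReal),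
        hmeas u hu hum]
      refine mul_le_mul_left ((measure_mono himg).trans_eq ?_) _
      rw [uIcc, Real.volume_Icc, max_sub_min_eq_abs, sub_zero]
    rcases le_or_gt x₀ t with hle | hlt
    · refine h3 (Ico x₀ t) (Ico_subset_Icc_self.trans (hs.out hx₀ ht)) measurableSet_Ico ?_ ?_
      · intro x
        simp only [hK, mem_ofPred_eq, mem_Ico]
        constructor
        · rintro (h | h)
          · exact h
          · exact absurd (h.1.trans h.2) hle.not_gt
        · exact Or.inl
      · rintro _ ⟨x, hx, rfl⟩
        have hxs := hs.out hx₀ ht (Ico_subset_Icc_self hx)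
        exact Icc_subset_uIcc ⟨hT0 ▸ hmono.monotoneOn hx₀ hxs hx.1,
          hmono.monotoneOn hxs ht hx.2.le⟩
    · refine h3 (Ioo t x₀) (Ioo_subset_Icc_self.trans (hs.out ht hx₀)) measurableSet_Ioo ?_ ?_
      · intro x
        simp only [hK, mem_ofPred_eq, mem_Ioo]
        constructor
        · rintro (h | h)
          · exact absurd (h.1.trans_lt h.2) hlt.not_gt
          · exact h
        · exact Or.inr
      · rintro _ ⟨x, hx, rfl⟩
        have hxs := hs.out ht hx₀ (Ioo_subset_Icc_self hx)
        exact Icc_subset_uIcc' ⟨hmono.monotoneOn ht hxs hx.1.le,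
          hT0 ▸ hmono.monotoneOn hxs hx₀ hx.2.le⟩
  calc ∫⁻ x in s, ENNReal.ofReal (T' x) * R x
      ≤ ∫⁻ x in s, ∫⁻ t in s, ENNReal.ofReal (T' x) * K.indicator (fun z => v z.2) (x, t) := by
        refine setLIntegral_mono' hsm fun x hx => ?_
        rw [lintegral_const_mul' _ _ ENNReal.ofReal_ne_top]
        exact mul_le_mul_right (h1 x hx) _
    _ = ∫⁻ t in s, ∫⁻ x in s, ENNReal.ofReal (T' x) * K.indicator (fun z => v z.2) (x, t) :=
        lintegral_lintegral_swap (hTm.ennreal_ofReal.comp_fst.mul hKv.aemeasurable)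
    _ ≤ _ := setLIntegral_mono' hsm h2

/-! ### The Stam inequality -/

/-- Absolute continuity enters only through continuity, which controls the ends of Ω. Inside Ω, r is
differentiable everywhere. -/
theorem continuous_of_absolutelyContinuousOnInterval {g : ℝ → ℝ}
    (hg : ∀ c d : ℝ, AbsolutelyContinuousOnInterval g c d) : Continuous g := by
  refine continuous_iff_continuousAt.2 fun x => ?_
  have h1 := (hg (x - 1) (x + 1)).continuousOn
  rw [uIcc_of_le (by linarith)] at h1
  exact h1.continuousAt (Icc_mem_nhds (by linarith) (by linarith))

theorem lintegral_abs_deriv_ratio_ne_top (hf : IsDensityOn a b f) (hh : IsDensityOn a b h)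
    (hα : 0 < α) (hdf : DifferentiableOn ℝ f (Omega a b))
    (hdh : DifferentiableOn ℝ h (Omega a b)) {p : ℝ} (hp : 1 ≤ p)
    (hF : relFisherDiv a b p α f h ≠ ⊤) :
    ∫⁻ x in Omega a b, ENNReal.ofReal |deriv (ratio α f h) x| ≠ ⊤ := by
  rcases hp.eq_or_lt with rfl | hp
  · rw [lintegral_abs_deriv_ratio hf hh hα hdf hdh]
    exact ENNReal.mul_ne_top ENNReal.ofReal_ne_top hF
  · refine ne_top_of_le_ne_top (ENNReal.mul_ne_top ENNReal.ofReal_ne_top ?_)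
      (lintegral_abs_deriv_ratio_le hf hh hα hdf hdh (Real.HolderConjugate.conjExponent hp))
    exact ENNReal.rpow_ne_top_of_nonneg (by positivity) hF

theorem ratio_le_of_lintegral (hf : IsDensityOn a b f) (hh : IsDensityOn a b h)
    (hdf : DifferentiableOn ℝ f (Omega a b)) (hdh : DifferentiableOn ℝ h (Omega a b))
    (hy : IsChangeOfVar a b α f h y) (hc : Continuous (transform a b α f h y))
    (hV : ∫⁻ x in Omega a b, ENNReal.ofReal |deriv (ratio α f h) x| ≠ ⊤) {x : ℝ}
    (hx : x ∈ Omega a b) : ratio α f h x ≤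
      (∫⁻ x in Omega a b, ENNReal.ofReal |deriv (ratio α f h) x|).toReal / 2 := by
  have h1 := ENNReal.toReal_mono hV (two_mul_ratio_le hf hh hdf hdh hy hc hx)
  rw [ENNReal.toReal_mul, ENNReal.toReal_ofReal (ratio_pos hf hh hx).le] at h1
  simp only [ENNReal.toReal_ofNat] at h1
  linarith

/-- For p = 1, r ≤ αF/2 pointwise with F the Fisher divergence, so α D = ∫ f log r ≤ log (αF/2). The
constant is at most 2. -/
theorem stamConst_one_rpow_le (hf : IsDensityOn a b f) (hh : IsDensityOn a b h) (hα : 0 < α)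
    (hdf : DifferentiableOn ℝ f (Omega a b)) (hdh : DifferentiableOn ℝ h (Omega a b))
    (hy : IsChangeOfVar a b α f h y) (hc : Continuous (transform a b α f h y))
    (hF : relFisherDiv a b 1 α f h ≠ ⊤)
    (hi : IntegrableOn (fun x => f x * Real.log (f x / h x)) (Omega a b)) :
    (stamConst 1 / ENNReal.ofReal α) ^ (1 / α) ≤
      EReal.exp (-klDivergence a b f h) * relFisher a b 1 α f h := by
  have hV := lintegral_abs_deriv_ratio_ne_top hf hh hα hdf hdh le_rfl hF
  set F := (relFisherDiv a b 1 α f h).toReal with hFdef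
  have hb : ∀ x ∈ Omega a b, ratio α f h x ≤ α * F / 2 := fun x hx => by
    have := ratio_le_of_lintegral hf hh hdf hdh hy hc hV hx
    rwa [lintegral_abs_deriv_ratio hf hh hα hdf hdh, ENNReal.toReal_mul,
      ENNReal.toReal_ofReal hα.le] at this
  obtain ⟨x₀, hx₀⟩ := hf.nonempty
  have hαF : 0 < α * F := by linarith [hb x₀ hx₀, ratio_pos (α := α) hf hh hx₀]
  have hF0 : 0 < F := pos_of_mul_pos_right hαF hα.le
  have key := integral_mul_log_le (μ := volume.restrict (Omega a b)) (f := f) (g := ratio α f h)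
    (A := α * F / 2) (by positivity) hf.integrableOn hf.setIntegral
    (Filter.Eventually.of_forall hf.nonneg)
    (by
      filter_upwards [ae_restrict_mem (measurableSet_Omega a b)] with x hx
      exact ratio_pos hf hh hx)
    (measurable_ratio hf hh).aestronglyMeasurable (integrableOn_mul_log_ratio hf hh hi)
    (by
      calc ∫⁻ x in Omega a b, ENNReal.ofReal (f x * ratio α f h x)
          ≤ ∫⁻ x in Omega a b, ENNReal.ofReal (f x) * ENNReal.ofReal (α * F / 2) := by
            refine setLIntegral_mono' (measurableSet_Omega a b) fun x hx => ?_
            rw [ENNReal.ofReal_mul (hf.nonneg x)]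
            exact mul_le_mul_right (ENNReal.ofReal_le_ofReal (hb x hx)) _
        _ = ENNReal.ofReal (α * F / 2) := by
            rw [lintegral_mul_const' _ _ ENNReal.ofReal_ne_top, hf.setLIntegral, one_mul])
  rw [setIntegral_mul_log_ratio hf hh] at key
  set D := ∫ x in Omega a b, f x * Real.log (f x / h x) with hD
  have h2 : stamConst 1 / ENNReal.ofReal α ≤ ENNReal.ofReal (2 / α) := by
    rw [ENNReal.ofReal_div_of_pos hα]
    exact ENNReal.div_le_div_right (by simpa using stamConst_one_le) _
  refine (ENNReal.rpow_le_rpow h2 (by positivity)).trans ?_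
  rw [relFisher, klDivergence_of_integrableOn hi, ← EReal.coe_neg, EReal.exp_coe,
    ← ENNReal.ofReal_toReal hF, ← hFdef, ENNReal.ofReal_rpow_of_pos (by positivity),
    ENNReal.ofReal_rpow_of_pos hF0, ← ENNReal.ofReal_mul (Real.exp_pos _).le]
  refine ENNReal.ofReal_le_ofReal ?_
  rw [← hD, ← Real.log_le_log_iff (by positivity) (by positivity),
    Real.log_mul (by positivity) (by positivity), Real.log_exp, Real.log_rpow (by positivity),
    Real.log_rpow hF0, Real.log_div two_ne_zero hα.ne', one_mul]
  rw [Real.log_div (by positivity) two_ne_zero, Real.log_mul hα.ne' hF0.ne'] at key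
  have h3 : -D + 1 / α * Real.log F = 1 / α * (Real.log F - α * D) := by
    field_simp
    ring
  rw [h3]
  exact mul_le_mul_of_nonneg_left (by linarith) (by positivity)

/-- The entropy form of the Stam inequality, in the original variable. -/
theorem mul_klDivergence_le_log (hf : IsDensityOn a b f) (hh : IsDensityOn a b h) (hα : 0 < α)
    (hdf : DifferentiableOn ℝ f (Omega a b)) (hdh : DifferentiableOn ℝ h (Omega a b))
    (hy : IsChangeOfVar a b α f h y) (hc : Continuous (transform a b α f h y)) {p q F : ℝ}
    (hpq : p.HolderConjugate q) (hF0 : 0 < F) (hF : relFisherDiv a b p α f h = ENNReal.ofReal F)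
    (hi : IntegrableOn (fun x => f x * Real.log (f x / h x)) (Omega a b)) :
    α * (∫ x in Omega a b, f x * Real.log (f x / h x)) + Real.log (partitionFn q) + 1 / q ≤
      Real.log (α * (F ^ (1 / p) * (1 / q) ^ (1 / q))) := by
  have hq := hpq.symm.pos
  have hO := measurableSet_Omega a b
  obtain ⟨T, hT⟩ := exists_transport hf hdf.continuousOn hq
  have hTc : ContinuousOn T (Omega a b) := fun x hx => (hT x hx).continuousAt.continuousWithinAt
  have hTm : AEMeasurable T (volume.restrict (Omega a b)) := hTc.aemeasurable hO
  have hGm : AEMeasurable (fun x => stretchedGaussian q (T x)) (volume.restrict (Omega a b)) :=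
    (continuous_stretchedGaussian hq).measurable.comp_aemeasurable hTm
  obtain ⟨x₀, hx₀, hT0⟩ := exists_transport_eq_zero hf hq hT
  have hmom := lintegral_abs_transport_rpow hf hq hT
  have hparts := lintegral_deriv_mul_le (ordConnected_Omega a b) hx₀ hT0
    (strictMonoOn_transport hf hq hT) hT
    (fun x _ => div_nonneg (hf.nonneg x) (stretchedGaussian_pos hq _).le)
    (hf.measurable.aemeasurable.div hGm) (measurable_deriv (ratio α f h)).abs.ennreal_ofReal
    (fun x hx => ratio_le_lintegral_right hf hh hdf hdh hy hc hx)
    (fun x hx => ratio_le_lintegral_left hf hh hdf hdh hy hc hx)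
  have hhold := lintegral_abs_deriv_ratio_mul_le hf hh hα hdf hdh hpq
    (k := fun x => ENNReal.ofReal |T x|) hTm.abs.ennreal_ofReal
  have hmom' : ∫⁻ x in Omega a b, ENNReal.ofReal (f x) * ENNReal.ofReal |T x| ^ q =
      ENNReal.ofReal (1 / q) := by
    rw [← hmom]
    refine lintegral_congr fun x => ?_
    rw [ENNReal.ofReal_rpow_of_nonneg (abs_nonneg _) hq.le, ← ENNReal.ofReal_mul (hf.nonneg x),
      mul_comm]
  rw [hmom', hF, ENNReal.ofReal_rpow_of_pos hF0, ENNReal.ofReal_rpow_of_pos (by positivity),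
    ← ENNReal.ofReal_mul (by positivity), ← ENNReal.ofReal_mul hα.le] at hhold
  have hpf0 : 0 ≤ᵐ[volume.restrict (Omega a b)] fun x => |T x| ^ q * f x :=
    Filter.Eventually.of_forall fun x => mul_nonneg (by positivity) (hf.nonneg x)
  have hpf : AEStronglyMeasurable (fun x => |T x| ^ q * f x) (volume.restrict (Omega a b)) :=
    ((hTm.abs.pow_const q).mul hf.measurable.aemeasurable).aestronglyMeasurable
  have hint : IntegrableOn (fun x => |T x| ^ q * f x) (Omega a b) :=
    ⟨hpf, (hasFiniteIntegral_iff_ofReal hpf0).2 (hmom ▸ ENNReal.ofReal_lt_top)⟩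
  have hlr := integrableOn_mul_log_ratio (α := α) hf hh hi
  have hrest : IntegrableOn (fun x => |T x| ^ q * f x + Real.log (partitionFn q) * f x)
      (Omega a b) := Integrable.add hint (hf.integrableOn.const_mul _)
  have hlog : EqOn (fun x => f x * Real.log (ratio α f h x) +
        (|T x| ^ q * f x + Real.log (partitionFn q) * f x))
      (fun x => f x * Real.log (ratio α f h x / stretchedGaussian q (T x))) (Omega a b) := by
    intro x hx
    dsimp only
    rw [Real.log_div (ratio_pos hf hh hx).ne' (stretchedGaussian_pos hq _).ne',
      log_stretchedGaussian hq]
    ring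
  -- Jensen with G = r / γ(T), where γ is the stretched Gaussian. Its mass hypothesis is the chain ∫
  -- f G = ∫ T' r ≤ ∫ |T| |r'| ≤ α F^(1/p) (1/q)^(1/q).
  have key := integral_mul_log_le (μ := volume.restrict (Omega a b)) (f := f)
    (g := fun x => ratio α f h x / stretchedGaussian q (T x))
    (A := α * (F ^ (1 / p) * (1 / q) ^ (1 / q))) (by positivity) hf.integrableOn hf.setIntegral
    (Filter.Eventually.of_forall hf.nonneg)
    (by
      filter_upwards [ae_restrict_mem hO] with x hx
      exact div_pos (ratio_pos hf hh hx) (stretchedGaussian_pos hq _))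
    ((measurable_ratio hf hh).aemeasurable.div hGm).aestronglyMeasurable
    (IntegrableOn.congr_fun (Integrable.add hlr hrest) hlog hO)
    (by
      refine le_trans (le_of_eq ?_) (hparts.trans (le_trans (le_of_eq ?_) hhold))
      · refine setLIntegral_congr_fun hO fun x hx => ?_
        rw [← ENNReal.ofReal_mul (div_nonneg (hf.nonneg x) (stretchedGaussian_pos hq _).le)]
        congr 1
        ring
      · exact lintegral_congr fun x => mul_comm _ _)
  rw [← setIntegral_congr_fun hO hlog, integral_add hlr hrest,
    integral_add hint (hf.integrableOn.const_mul _), integral_const_mul, hf.setIntegral,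
    setIntegral_mul_log_ratio hf hh, integral_eq_lintegral_of_nonneg_ae hpf0 hpf, hmom,
    ENNReal.toReal_ofReal (by positivity)] at key
  linarith

theorem stamConst_rpow_le (hf : IsDensityOn a b f) (hh : IsDensityOn a b h) (hα : 0 < α)
    (hdf : DifferentiableOn ℝ f (Omega a b)) (hdh : DifferentiableOn ℝ h (Omega a b))
    (hy : IsChangeOfVar a b α f h y) (hc : Continuous (transform a b α f h y)) {p q : ℝ}
    (hpq : p.HolderConjugate q) (hF : relFisherDiv a b p α f h ≠ ⊤)
    (hi : IntegrableOn (fun x => f x * Real.log (f x / h x)) (Omega a b)) :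
    (stamConst p / ENNReal.ofReal α) ^ (1 / α) ≤
      EReal.exp (-klDivergence a b f h) * relFisher a b p α f h := by
  have hp := hpq.pos
  have hq := hpq.symm.pos
  have hZ := partitionFn_pos hq
  -- A vanishing Fisher divergence would give r zero variation, but twice the positive value of r at
  -- any point is bounded by that variation.
  have hFne : relFisherDiv a b p α f h ≠ 0 := by
    intro h0
    have h1 := lintegral_abs_deriv_ratio_le hf hh hα hdf hdh hpq
    rw [h0, ENNReal.zero_rpow_of_pos (by positivity), mul_zero] at h1
    obtain ⟨x₀, hx₀⟩ := hf.nonempty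
    have h2 := (two_mul_ratio_le hf hh hdf hdh hy hc hx₀).trans h1
    have h3 := ENNReal.ofReal_pos.2 (ratio_pos (α := α) hf hh hx₀)
    exact (ENNReal.mul_pos two_ne_zero h3.ne').not_ge h2
  have hF0 := ENNReal.toReal_pos hFne hF
  have key := mul_klDivergence_le_log hf hh hα hdf hdh hy hc hpq hF0
    (ENNReal.ofReal_toReal hF).symm hi
  rw [relFisher, klDivergence_of_integrableOn hi, ← EReal.coe_neg, EReal.exp_coe,
    stamConst_eq hpq, ← ENNReal.ofReal_toReal hF, ← ENNReal.ofReal_div_of_pos hα,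
    ENNReal.ofReal_rpow_of_pos (by positivity), ENNReal.ofReal_rpow_of_pos hF0,
    ← ENNReal.ofReal_mul (Real.exp_pos _).le]
  refine ENNReal.ofReal_le_ofReal ?_
  set D := ∫ x in Omega a b, f x * Real.log (f x / h x)
  set F := (relFisherDiv a b p α f h).toReal
  rw [Real.log_mul hα.ne' (by positivity), Real.log_mul (by positivity) (by positivity),
    Real.log_rpow hF0, Real.log_rpow (by positivity), one_div q, Real.log_inv] at key
  rw [← Real.log_le_log_iff (by positivity) (by positivity),
    Real.log_mul (by positivity) (by positivity), Real.log_exp, Real.log_rpow (by positivity),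
    Real.log_rpow hF0, Real.log_div (by positivity) hα.ne', Real.log_mul (by positivity)
    (by positivity), Real.log_mul hZ.ne' (by positivity), Real.log_exp, Real.log_rpow hq, one_div q]
  have h3 : -D + 1 / (p * α) * Real.log F = 1 / α * (1 / p * Real.log F - α * D) := by
    field_simp
    ring
  rw [h3]
  exact mul_le_mul_of_nonneg_left (by linarith) (by positivity)

end RelEscort

/-- Here `q` is the exponent `p*` of the moment inequality. The last hypothesis of the Stam-type
inequality only excludes the indeterminate product `0 * ∞`. -/
theorem theorem2 (a b : EReal) (f h : ℝ → ℝ)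
    (hf : RelEscort.IsDensityOn a b f) (hh : RelEscort.IsDensityOn a b h)
    (α : ℝ) (hα : 0 < α) :
    (∀ q : ℝ, 0 < q →
      RelEscort.momentEntropyConst q ^ (1 / α) ≤
          RelEscort.canonicalRelCumDeviation a b q α f h *
            EReal.exp (RelEscort.klDivergence a b f h) ∧
        ∀ y : ℝ → ℝ, RelEscort.IsChangeOfVar a b α f h y →
          RelEscort.momentEntropyConst q ^ (1 / α) ≤
            RelEscort.relCumDeviation a b q α f h y *
              EReal.exp (RelEscort.klDivergence a b f h)) ∧
    (∀ p : ℝ, 1 ≤ p →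
      DifferentiableOn ℝ f (RelEscort.Omega a b) →
      DifferentiableOn ℝ h (RelEscort.Omega a b) →
      ∀ y : ℝ → ℝ, RelEscort.IsChangeOfVar a b α f h y →
      (∀ c d : ℝ, AbsolutelyContinuousOnInterval (RelEscort.transform a b α f h y) c d) →
      (RelEscort.klDivergence a b f h ≠ ⊤ ∨ RelEscort.relFisher a b p α f h ≠ ⊤) →
      (RelEscort.stamConst p / ENNReal.ofReal α) ^ (1 / α) ≤
        EReal.exp (-RelEscort.klDivergence a b f h) * RelEscort.relFisher a b p α f h) := by
  refine ⟨fun q hq => ⟨RelEscort.momentEntropyConst_rpow_le_canonical hf hh hα hq,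
    fun y hy => ?_⟩, fun p hp hdf hdh y hy hac hne => ?_⟩
  · rw [RelEscort.relCumDeviation, RelEscort.relCumMoment_eq hf hh hy q]
    exact RelEscort.momentEntropyConst_rpow_le hf hh hα hy hq
  have hp0 : 0 < p := zero_lt_one.trans_le hp
  have hexp : 0 < 1 / (p * α) := by positivity
  -- If the Fisher divergence is infinite, D is finite by hypothesis, so exp(-D) > 0 and the
  -- right-hand side is infinite.
  by_cases hF : RelEscort.relFisherDiv a b p α f h = ⊤
  · have hφ : RelEscort.relFisher a b p α f h = ⊤ := by
      rw [RelEscort.relFisher, hF, ENNReal.top_rpow_of_pos hexp]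
    have hD := hne.resolve_right (not_not.2 hφ)
    rw [hφ, ENNReal.mul_top]
    · exact le_top
    · rwa [Ne, EReal.exp_eq_zero_iff, EReal.neg_eq_bot_iff]
  have hc := RelEscort.continuous_of_absolutelyContinuousOnInterval hac
  -- A finite Fisher divergence bounds r, hence D is automatically finite.
  have hi := RelEscort.integrableOn_mul_log_div hf hh hα fun x hx =>
    RelEscort.ratio_le_of_lintegral hf hh hdf hdh hy hc
      (RelEscort.lintegral_abs_deriv_ratio_ne_top hf hh hα hdf hdh hp hF) hx
  rcases hp.eq_or_lt with rfl | hp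
  · exact RelEscort.stamConst_one_rpow_le hf hh hα hdf hdh hy hc hF hi
  · exact RelEscort.stamConst_rpow_le hf hh hα hdf hdh hy hc
      (Real.HolderConjugate.conjExponent hp) hF hi
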